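/- **Conventions.** A morphism of discrete cubes is a map $\rho:\{0,1\}^k\to\{0,1\}^\ell$ each of whose coordinates is one of $0$, $1$, $x_j$, $1-x_j$. A cubespace is a metrizable space $X$ with closed sets $C^k(X)\subseteq X^{\{0,1\}^k}$ ($k\ge 0$) of "$k$-cubes" such that $C^0(X)=X$ and $c\circ\rho\in C^k(X)$ whenever $c\in C^\ell(X)$ and $\rho:\{0,1\}^k\to\{0,1\}^\ell$ is a morphism of discrete cubes. It is ergodic if $C^1(X)=X^2$. It has the glueing property if, whenever $c,c'\in C^k(X)$ $(k\ge1)$ satisfy $c(\omega1)=c'(\omega0)$ for all $\omega\in\{0,1\}^{k-1}$, the configuration equal to $c$ on $\{\omega_k=0\}$ and to $c'$ on $\{\omega_k=1\}$ is a $k$-cube. The quotient of a compact cubespace by a closed equivalence relation carries the quotient topology, and its cubes are the images of cubes. An isomorphism of cubespaces is a homeomorphism that identifies the cubes. A $k$-corner of $X$ is a map $\lambda:\{0,1\}^k\setminus\{\vec 1\}\to X$ whose restrictions to the faces $\{\omega_i=0\}$ are $(k-1)$-cubes. A fibration $f:X\to Y$ is a continuous map sending cubes to cubes such that, for every $k\ge0$,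 $c\in C^k(Y)$ and $k$-corner $\lambda$ of $X$ with $f\circ\lambda=c$ off $\vec 1$, there is $\tilde c\in C^k(X)$ extending $\lambda$ with $f\circ\tilde c=c$. The map $f$ has $k$-uniqueness if $c=c'$ whenever $c,c'\in C^k(X)$, $f\circ c=f\circ c'$ and $c=c'$ off $\vec 1$. A fibration has degree at most $s$ if it has $k$-uniqueness for some $k\le s+1$. The map $f$ is relatively $k$-ergodic if for $1\le\ell\le k$ every configuration $c\in X^{\{0,1\}^\ell}$ with $f\circ c\in C^\ell(Y)$ is an $\ell$-cube. For $i\ge0$ write $x\sim_{f,i}x'$ if there are $c,c'\in C^{i+1}(X)$ with $f\circ c=f\circ c'$, $c(\vec1)=x$, $c'(\vec1)=x'$ and $c=c'$ off $\vec 1$; put $\pi_{f,i}(X)=X/\!\sim_{f,i}$. For an abelian group $A$, $C^k(\mathcal D_i(A))$ is the subgroup of $A^{\{0,1\}^k}$ generated by the configurations equal to $a\in A$ on $\{\omega:\omega_j=1\ \forall j\in S\}$ and $0$ elsewhere, over all $S\subseteq\{1,\dots,k\}$ with $|S|\le i$. **Statement.** Let $f:X\to Y$ be a fibration of degree at most $s$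 ($s \geq 0$) between compact ergodic cubespaces with the glueing property. For $0\le i\le s$, $\sim_{f,i}$ is a closed equivalence relation, $\pi_{f,i}(X)$ is a compact ergodic cubespace with the glueing property, and $f$ factors as $X\to\pi_{f,i}(X)\to Y$, where both maps are fibrations and the second has degree at most $i$. These spaces form a tower $$X=\pi_{f,s}(X)\to\pi_{f,s-1}(X)\to\cdots\to\pi_{f,0}(X)=Y$$ factoring $f$: the induced maps $p_i:\pi_{f,i}(X)\to\pi_{f,i-1}(X)$ are well defined and compatible with the maps from $X$ and to $Y$, and $X\to\pi_{f,s}(X)$ and $\pi_{f,0}(X)\to Y$ are isomorphisms of cubespaces. For every $1\le i\le s$, $p_i$ is a relatively $i$-ergodic fibration of degree at most $i$, and there is a compact (metrizable) abelian topological group $A_i=A_i(f)$ acting continuously on $\pi_{f,i}(X)$ such that: 1. the action is free and its orbits are precisely the fibres of $p_i$; 2. for every $k\ge0$ the pointwise action of $C^k(\mathcal D_i(A_i))$ preserves $C^k(\pi_{f,i}(X))$, is free, and its orbits are precisely the fibres of $C^k(\pi_{f,i}(X))\to C^k(\pi_{f,i-1}(X))$; 3. if $x,x'$ lie in one fibre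 of $p_i$ and $y,y'$ in one fibre of $p_i$, then there is $a\in A_i$ with $a.x=x'$ and $a.y=y'$ if and only if the configuration on $\{0,1\}^{i+1}$ with value $x'$ at $(1,\dots,1,0)$, $y'$ at $(1,\dots,1,1)$, $x$ at all other vertices with last coordinate $0$ and $y$ at all other vertices with last coordinate $1$ is a cube of $\pi_{f,i}(X)$. -/

import Mathlib

open Set Topology

universe u v

/-! ## Discrete cubes -/

/-- The discrete cube `{0,1}^k`. -/
abbrev DCube (k : ℕ) : Type := Fin k → Bool

/-- The top vertex `(1, …, 1)` of the discrete cube. -/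
def ones (k : ℕ) : DCube k := fun _ => true

/-- Morphisms of discrete cubes: every coordinate of `ρ` is identically `0`, identically `1`,
some coordinate `x_j`, or some `1 - x_j`. -/
def IsCubeMorphism {k l : ℕ} (ρ : DCube k → DCube l) : Prop :=
  ∀ i : Fin l, (∃ b : Bool, ∀ x, ρ x i = b) ∨ (∃ j : Fin k, ∀ x, ρ x i = x j) ∨
    (∃ j : Fin k, ∀ x, ρ x i = !(x j))

/-! ## Cubespaces -/

/-- The combinatorial part of a cubespace structure on `X`: sets `C^k(X)` of `k`-cubes, stable
under composition with morphisms of discrete cubes, with `C^0(X) = X`. -/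
class CubeStructure (X : Type u) where
  cubes : ∀ k : ℕ, Set (DCube k → X)
  comp_mem : ∀ {k l : ℕ} (ρ : DCube k → DCube l), IsCubeMorphism ρ →
    ∀ c ∈ cubes l, c ∘ ρ ∈ cubes k
  cubes_zero : cubes 0 = Set.univ

/-- `Cubes X k` is the set `C^k(X)` of `k`-cubes of `X`. -/
def Cubes (X : Type u) [CubeStructure X] (k : ℕ) : Set (DCube k → X) := CubeStructure.cubes k

/-- `X` is a compact cubespace: a compact metrizable space whose sets of cubes are closed. -/
structure IsCompactCubespace (X : Type u) [TopologicalSpace X] [CubeStructure X] : Prop where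
  compact : CompactSpace X
  metrizable : TopologicalSpace.MetrizableSpace X
  closed : ∀ k : ℕ, IsClosed (Cubes X k)

/-- `X` is ergodic: every pair of points is a `1`-cube. -/
def IsErgodic (X : Type u) [CubeStructure X] : Prop := Cubes X 1 = Set.univ

/-- The glueing property: glueing two cubes along a common face (in the last coordinate) yields a
cube. -/
def HasGlueing (X : Type u) [CubeStructure X] : Prop :=
  ∀ (n : ℕ) (c c' : DCube (n + 1) → X), c ∈ Cubes X (n + 1) → c' ∈ Cubes X (n + 1) →
    (∀ ω : DCube n, c (Fin.snoc (α := fun _ => Bool) ω true) =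
      c' (Fin.snoc (α := fun _ => Bool) ω false)) →
    (fun ω : DCube (n + 1) => if ω (Fin.last n) = true then c' ω else c ω) ∈ Cubes X (n + 1)

/-! ## Morphisms, corners and fibrations -/

/-- Cubespace morphisms: continuous maps that send cubes to cubes. -/
structure IsMorphism {X : Type u} {Y : Type v} [TopologicalSpace X] [TopologicalSpace Y]
    [CubeStructure X] [CubeStructure Y] (f : X → Y) : Prop where
  continuous : Continuous f
  map_cubes : ∀ (k : ℕ), ∀ c ∈ Cubes X k, f ∘ c ∈ Cubes Y k

/-- Isomorphisms of cubespaces: homeomorphisms that identify the cubes. -/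
structure IsCubespaceIso {X : Type u} {Y : Type v} [TopologicalSpace X] [TopologicalSpace Y]
    [CubeStructure X] [CubeStructure Y] (f : X → Y) : Prop where
  homeo : IsHomeomorph f
  cubes_iff : ∀ (k : ℕ) (c : DCube k → X), f ∘ c ∈ Cubes Y k ↔ c ∈ Cubes X k

theorem insertNth_false_ne_ones {n : ℕ} (i : Fin (n + 1)) (ω : DCube n) :
    (i.insertNth (α := fun _ => Bool) false ω : DCube (n + 1)) ≠ ones (n + 1) := by
  intro h
  have := congrFun h i
  simp [ones] at this

/-- `k`-corners: configurations on `{0,1}^k` without the vertex `(1, …, 1)`, all of whose lower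
faces `ω_i = 0` are `(k-1)`-cubes. -/
def IsCubeCorner {X : Type u} [CubeStructure X] :
    (k : ℕ) → ({ω : DCube k // ω ≠ ones k} → X) → Prop
  | 0, _ => True
  | n + 1, l => ∀ i : Fin (n + 1),
      (fun ω : DCube n =>
        l ⟨i.insertNth (α := fun _ => Bool) false ω, insertNth_false_ne_ones i ω⟩) ∈ Cubes X n

/-- Fibrations: morphisms `f` such that, whenever `c` is a `k`-cube of `Y` and `l` is a `k`-corner
of `X` lying above `c`, the corner `l` has a completion to a `k`-cube of `X` lying above `c`. -/
structure IsFibration {X : Type u} {Y : Type v} [TopologicalSpace X] [TopologicalSpace Y]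
    [CubeStructure X] [CubeStructure Y] (f : X → Y) : Prop extends IsMorphism f where
  lift : ∀ (k : ℕ), ∀ c ∈ Cubes Y k, ∀ l : {ω : DCube k // ω ≠ ones k} → X, IsCubeCorner k l →
    (∀ ω, f (l ω) = c ω.1) →
    ∃ c' ∈ Cubes X k, (∀ ω, c' ω.1 = l ω) ∧ f ∘ c' = c

/-- Relative `k`-uniqueness of `f`. -/
def RelUniqueness {X : Type u} {Y : Type v} [CubeStructure X] (f : X → Y) (k : ℕ) : Prop :=
  ∀ c ∈ Cubes X k, ∀ c' ∈ Cubes X k, f ∘ c = f ∘ c' →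
    (∀ ω, ω ≠ ones k → c ω = c' ω) → c = c'

/-- `f` has degree at most `s`: the smallest `k` for which `f` has `k`-uniqueness exists and is at
most `s + 1`. -/
def DegreeAtMost {X : Type u} {Y : Type v} [CubeStructure X] (f : X → Y) (s : ℕ) : Prop :=
  ∃ k ≤ s + 1, RelUniqueness f k

/-- `f` is relatively `k`-ergodic: for `1 ≤ l ≤ k`, every configuration that lies above an
`l`-cube is an `l`-cube. -/
def RelErgodic {X : Type u} {Y : Type v} [CubeStructure X] [CubeStructure Y]
    (f : X → Y) (k : ℕ) : Prop :=
  ∀ l : ℕ, 1 ≤ l → l ≤ k → ∀ c : DCube l → X, f ∘ c ∈ Cubes Y l → c ∈ Cubes X l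

/-! ## Quotients and the canonical factors of a fibration -/

/-- The quotient cube structure: the cubes are the images of the cubes of `X`. -/
instance quotCubeStructure {X : Type u} [CubeStructure X] (r : X → X → Prop) :
    CubeStructure (Quot r) where
  cubes k := (fun c : DCube k → X => Quot.mk r ∘ c) '' Cubes X k
  comp_mem := by
    rintro k l ρ hρ _ ⟨c, hc, rfl⟩
    exact ⟨c ∘ ρ, CubeStructure.comp_mem ρ hρ c hc, rfl⟩
  cubes_zero := by
    refine Set.eq_univ_of_forall fun c => ?_
    obtain ⟨x, hx⟩ := Quot.exists_rep (c (ones 0))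
    refine ⟨fun _ => x, ?_, ?_⟩
    · change _ ∈ CubeStructure.cubes 0
      rw [CubeStructure.cubes_zero]
      trivial
    · funext ω
      rw [Subsingleton.elim ω (ones 0)]
      exact hx

/-- The relation `x ∼_{f,s} x'`: there are two `(s+1)`-cubes with the same image under `f` that
agree except that they take the values `x` and `x'` at the vertex `(1, …, 1)`. -/
def CanonRel {X : Type u} {Y : Type v} [CubeStructure X] (f : X → Y) (s : ℕ) (x x' : X) : Prop :=
  ∃ c ∈ Cubes X (s + 1), ∃ c' ∈ Cubes X (s + 1), f ∘ c = f ∘ c' ∧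
    c (ones (s + 1)) = x ∧ c' (ones (s + 1)) = x' ∧ ∀ ω, ω ≠ ones (s + 1) → c ω = c' ω

/-- The canonical factor `π_{f,s}(X) = X / ∼_{f,s}`, with the quotient topology and the quotient
cube structure. -/
abbrev Factor {X : Type u} {Y : Type v} [CubeStructure X] (f : X → Y) (s : ℕ) : Type u :=
  Quot (CanonRel f s)

/-- The projection `X → π_{f,s}(X)`. -/
def proj {X : Type u} {Y : Type v} [CubeStructure X] (f : X → Y) (s : ℕ) : X → Factor f s :=
  Quot.mk _

theorem CanonRel.map_eq {X : Type u} {Y : Type v} [CubeStructure X] {f : X → Y} {s : ℕ}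
    {x x' : X} (h : CanonRel f s x x') : f x = f x' := by
  obtain ⟨c, -, c', -, hf, rfl, rfl, -⟩ := h
  exact congrFun hf _

theorem CanonRel.pred {X : Type u} {Y : Type v} [CubeStructure X] {f : X → Y} {s : ℕ}
    {x x' : X} (h : CanonRel f (s + 1) x x') : CanonRel f s x x' := by
  obtain ⟨c, hc, c', hc', hf, rfl, rfl, hω⟩ := h
  let ρ : DCube (s + 1) → DCube (s + 1 + 1) := fun ω => Fin.snoc (α := fun _ => Bool) ω true
  have hρ : IsCubeMorphism ρ := by
    intro i
    refine Fin.lastCases ?_ (fun j => ?_) i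
    · exact Or.inl ⟨true, fun x => by simp [ρ]⟩
    · exact Or.inr (Or.inl ⟨j, fun x => by simp [ρ]⟩)
  have h1 : ρ (ones (s + 1)) = ones (s + 1 + 1) := by
    funext i
    refine Fin.lastCases ?_ (fun j => ?_) i <;> simp [ρ, ones]
  refine ⟨c ∘ ρ, CubeStructure.comp_mem ρ hρ c hc, c' ∘ ρ, CubeStructure.comp_mem ρ hρ c' hc',
    ?_, ?_, ?_, ?_⟩
  · funext ω
    exact congrFun hf (ρ ω)
  · simp [h1]
  · simp [h1]
  · intro ω hne
    refine hω _ fun h => hne ?_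
    funext i
    have := congrFun h i.castSucc
    simpa [ρ, ones] using this

/-- The map `π_{f,s}(X) → Y` induced by `f`. -/
def toBase {X : Type u} {Y : Type v} [CubeStructure X] (f : X → Y) (s : ℕ) : Factor f s → Y :=
  Quot.lift f fun _ _ h => h.map_eq

/-- The step `π_{f,i+1}(X) → π_{f,i}(X)` of the tower, induced by the identity of `X`. -/
def step {X : Type u} {Y : Type v} [CubeStructure X] (f : X → Y) (i : ℕ) :
    Factor f (i + 1) → Factor f i :=
  Quot.lift (proj f i) fun _ _ h => Quot.sound h.pred

/-! ## Host–Kra cubes and structure groups -/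

/-- The Host–Kra cube group `HK^k(A_•)` of an abelian group with a filtration `A_•`: it is
generated by the configurations `[a]_{F_S}`, equal to `a ∈ A_{|S|}` on the upper face
`F_S = {ω : ω_i = 1 for all i ∈ S}` and to `0` elsewhere. -/
def hostKra {A : Type u} [AddCommGroup A] (F : ℕ → AddSubgroup A) (k : ℕ) :
    AddSubgroup (DCube k → A) :=
  AddSubgroup.closure {c | ∃ S : Finset (Fin k), ∃ a ∈ F S.card,
    c = fun ω => if ∀ i ∈ S, ω i = true then a else 0}

/-- The filtration `A = A_0 = A_1 = ⋯ = A_s ⊇ A_{s+1} = 0` on an abelian group. -/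
def degreeFiltration (A : Type u) [AddCommGroup A] (s : ℕ) : ℕ → AddSubgroup A :=
  fun j => if j ≤ s then ⊤ else ⊥

/-- The set `C^k(𝒟_s(A))` of `k`-cubes, as a subgroup of `A^{{0,1}^k}`. -/
def dCubes (A : Type u) [AddCommGroup A] (s k : ℕ) : AddSubgroup (DCube k → A) :=
  hostKra (degreeFiltration A s) k

/-- The configuration equal to `y` at `(1, …, 1)` and to `x` elsewhere. -/
def cornerConfig {X : Type u} (k : ℕ) (x y : X) : DCube k → X :=
  fun ω => if ω = ones k then y else x

/-- The `(k+1)`-configuration `[c, c']` that equals `c` where the last coordinate is `0` and `c'`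
where it is `1`. -/
def pairConfig {X : Type u} {k : ℕ} (c c' : DCube k → X) : DCube (k + 1) → X :=
  fun ω => if ω (Fin.last k) = true then c' (Fin.init ω) else c (Fin.init ω)

/-- `A`, acting on `X`, is the structure group of the (relatively `s`-ergodic, degree at most `s`)
fibration `g : X → Y`: it is a compact abelian group acting continuously and freely on `X`, its
orbits are the fibres of `g`, the pointwise action of `C^k(𝒟_s(A))` preserves `C^k(X)` and is
free, with orbits the fibres of `C^k(X) → C^k(Y)`.  The last field says that the elements of `A`
are the classes of pairs of points lying in a common fibre of `g`, where `(x, x')` and `(y, y')`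
are equivalent if `[⌞^s(x; x'), ⌞^s(y; y')]` is a cube. -/
structure IsStructureGroup {X : Type u} {Y : Type v} [TopologicalSpace X] [CubeStructure X]
    (s : ℕ) (g : X → Y) (A : Type u) [AddCommGroup A] [TopologicalSpace A] [AddAction A X] :
    Prop where
  topGroup : IsTopologicalAddGroup A
  compact : CompactSpace A
  metrizable : TopologicalSpace.MetrizableSpace A
  continuous : ContinuousVAdd A X
  free : ∀ (a : A) (x : X), a +ᵥ x = x → a = 0
  orbits : ∀ x x' : X, g x = g x' ↔ ∃ a : A, a +ᵥ x = x'
  cubes_action : ∀ k : ℕ, ∀ a ∈ dCubes A s k, ∀ c ∈ Cubes X k, (fun ω => a ω +ᵥ c ω) ∈ Cubes X k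
  cubes_free : ∀ k : ℕ, ∀ a ∈ dCubes A s k, ∀ c ∈ Cubes X k, (fun ω => a ω +ᵥ c ω) = c → a = 0
  cubes_orbits : ∀ k : ℕ, ∀ c ∈ Cubes X k, ∀ c' ∈ Cubes X k,
    g ∘ c = g ∘ c' ↔ ∃ a ∈ dCubes A s k, (fun ω => a ω +ᵥ c ω) = c'
  classes : ∀ x x' y y' : X, g x = g x' → g y = g y' →
    (pairConfig (cornerConfig s x x') (cornerConfig s y y') ∈ Cubes X (s + 1) ↔
      ∃ a : A, a +ᵥ x = x' ∧ a +ᵥ y = y')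

/-! ## Compact spaces: closed graphs and quotients -/

/-! Glueing puts every instance of `∼_{f,i}` into a standard form: the points lie over the same
point of `Y` and `⌞^{i+1}(x; x')` is a cube (`canonRel_iff`). This condition is closed, and two
complementary facts follow from it. In cubes of dimension at most `i + 1` vertices may be exchanged
freely for equivalent ones (`CanonRel.replace`); in dimension at least `i + 1` the class of the top
vertex is determined by the other classes and the image in `Y` (`canonRel_ones`). Together they make
`X → π_{f,i}(X)` a fibration; the first gives the relative ergodicity of the steps, the second their
degree. Fibrations pass to the second factor of a composition (`IsFibration.of_comp`), and the two
ends of the tower are injective fibrations, hence isomorphisms.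

Let `g : Z → W` be a step with parameter `s`. A pair `(x, x')` in a fibre can be transported to any
`y` in exactly one way (`existsUnique_transport`): the required corner is free by relative
ergodicity, its completion exists by the fibration property and is unique by the degree bound.
Transports compose in both directions by glueing, so the fibre of a base point becomes a group of
translations, free and transitive on each fibre. It is abelian because a transport square inside one
fibre can be transposed (`transport_transpose`), and the action is continuous because its graph is
closed.

Translating an upper face of codimension at most `s` preserves cubes (`translate_face_mem`), so
Host–Kra cubes act on cubes. Conversely, the difference of two cubes over the same cube can be
realized by a Host–Kra cube at the vertices of weight at most `s` (`exists_mem_dCubes_eq`), and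
uniqueness forces equality at the remaining vertices. -/

theorem continuous_of_isClosed_graph_of_compact {X : Type*} {Y : Type*} [TopologicalSpace X]
    [TopologicalSpace Y] [CompactSpace Y] (f : X → Y) (h : IsClosed {p : X × Y | f p.1 = p.2}) :
    Continuous f := by
  refine continuous_iff_isClosed.2 fun C hC => ?_
  have : f ⁻¹' C = Prod.fst '' ({p : X × Y | f p.1 = p.2} ∩ Prod.snd ⁻¹' C) := by
    ext x
    constructor
    · intro hx
      exact ⟨(x, f x), ⟨rfl, hx⟩, rfl⟩
    · rintro ⟨⟨a, b⟩, ⟨h1, h2⟩, rfl⟩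
      change f a = b at h1
      change f a ∈ C
      rw [h1]
      exact h2
  rw [this]
  exact isClosedMap_fst_of_compactSpace _ (h.inter (hC.preimage continuous_snd))

/-- The saturation of a closed set `C` is the projection of the closed set `ker p ∩ (C × X)` along a
compact factor. -/
theorem isClosedMap_of_isClosed_ker {X : Type*} {Z : Type*} [TopologicalSpace X]
    [TopologicalSpace Z] [CompactSpace X] {p : X → Z} (hp : IsQuotientMap p)
    (h : IsClosed {q : X × X | p q.1 = p q.2}) : IsClosedMap p := by
  intro C hC
  rw [← hp.isClosed_preimage]
  have : p ⁻¹' (p '' C) = Prod.snd '' ({q : X × X | p q.1 = p q.2} ∩ Prod.fst ⁻¹' C) := by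
    ext x
    constructor
    · rintro ⟨y, hy, hyx⟩
      exact ⟨(y, x), ⟨hyx, hy⟩, rfl⟩
    · rintro ⟨⟨a, b⟩, ⟨h1, h2⟩, rfl⟩
      exact ⟨a, h2, h1⟩
  rw [this]
  exact isClosedMap_snd_of_compactSpace _ (h.inter (hC.preimage continuous_fst))

/-- Two distinct fibres are disjoint compact sets, hence separated in `X`; since `p` is closed, the
points whose whole fibre lies in a given open set form an open set. -/
theorem t2Space_of_isClosed_ker {X : Type*} {Z : Type*} [TopologicalSpace X]
    [TopologicalSpace Z] [CompactSpace X] [T2Space X] {p : X → Z} (hp : IsQuotientMap p)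
    (h : IsClosed {q : X × X | p q.1 = p q.2}) : T2Space Z := by
  have hcl := isClosedMap_of_isClosed_ker hp h
  have hfib : ∀ z, IsClosed (p ⁻¹' {z}) := fun z => by
    obtain ⟨x, rfl⟩ := hp.surjective z
    have := (hcl {x} isClosed_singleton).preimage hp.continuous
    rwa [image_singleton] at this
  refine ⟨fun z w hzw => ?_⟩
  obtain ⟨U, V, hU, hV, hzU, hwV, hUV⟩ := SeparatedNhds.of_isCompact_isCompact
    (hfib z).isCompact (hfib w).isCompact
    (disjoint_left.2 fun x hx hx' => hzw (by rw [← mem_singleton_iff.1 hx]; exact hx'))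
  refine ⟨(p '' Uᶜ)ᶜ, (p '' Vᶜ)ᶜ, (hcl _ hU.isClosed_compl).isOpen_compl,
    (hcl _ hV.isClosed_compl).isOpen_compl, ?_, ?_, ?_⟩
  · rintro ⟨x, hx, rfl⟩
    exact hx (hzU rfl)
  · rintro ⟨x, hx, rfl⟩
    exact hx (hwV rfl)
  · rw [disjoint_left]
    intro y hy hy'
    obtain ⟨x, rfl⟩ := hp.surjective y
    have h1 : x ∈ U := by
      by_contra hx
      exact hy ⟨x, hx, rfl⟩
    have h2 : x ∈ V := by
      by_contra hx
      exact hy' ⟨x, hx, rfl⟩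
    exact disjoint_left.1 hUV h1 h2

/-- Pulling back functions embeds `C(Z, ℝ)` isometrically into the second countable space `C(X, ℝ)`.
A dense sequence in `C(Z, ℝ)` then separates the points of `Z` by Urysohn's lemma. -/
theorem metrizableSpace_of_continuous_surjective {X : Type*} {Z : Type*} [TopologicalSpace X]
    [TopologicalSpace Z] [CompactSpace X] [TopologicalSpace.MetrizableSpace X] [T2Space Z]
    {p : X → Z} (hp : Continuous p) (hs : Function.Surjective p) :
    TopologicalSpace.MetrizableSpace Z := by
  have : CompactSpace Z := by
    rw [← isCompact_univ_iff, ← hs.range_eq]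
    exact isCompact_range hp
  let F : C(Z, ℝ) → C(X, ℝ) := fun g => g.comp ⟨p, hp⟩
  have hF : Isometry F := by
    refine Isometry.of_dist_eq fun g g' => le_antisymm ?_ ?_
    · exact (ContinuousMap.dist_le dist_nonneg).2 fun x =>
        ContinuousMap.dist_apply_le_dist (f := g) (g := g') (p x)
    · refine (ContinuousMap.dist_le dist_nonneg).2 fun z => ?_
      obtain ⟨x, rfl⟩ := hs z
      exact ContinuousMap.dist_apply_le_dist (f := F g) (g := F g') x
  have : SecondCountableTopology X := inferInstance
  have : SecondCountableTopology C(Z, ℝ) := hF.isEmbedding.secondCountableTopology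
  let d : ℕ → C(Z, ℝ) := TopologicalSpace.denseSeq C(Z, ℝ)
  refine Metric.PiNatEmbed.TopologicalSpace.MetrizableSpace.of_countable_separating (fun i => (d i : Z → ℝ))
    (fun i => (d i).continuous) fun z w hzw => ?_
  obtain ⟨g, hg0, hg1, -⟩ := exists_continuous_zero_one_of_isClosed
    (isClosed_singleton (x := z)) (isClosed_singleton (x := w)) (by simpa using hzw)
  obtain ⟨i, hi⟩ := (TopologicalSpace.denseRange_denseSeq C(Z, ℝ)).exists_dist_lt g
    (ε := 1 / 2) (by norm_num)
  refine ⟨i, fun h => ?_⟩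
  have h1 := (ContinuousMap.dist_apply_le_dist (f := g) (g := d i) z).trans_lt hi
  have h2 := (ContinuousMap.dist_apply_le_dist (f := g) (g := d i) w).trans_lt hi
  rw [hg0 rfl, Real.dist_eq, abs_lt] at h1
  rw [hg1 rfl, Real.dist_eq, abs_lt] at h2
  simp only [Pi.zero_apply, Pi.one_apply] at h1 h2
  linarith [h1.1, h1.2, h2.1, h2.2]

/-! ## Cubes and glueing -/

section Cubes

variable {X : Type u} [CubeStructure X] {k l : ℕ}

theorem Cubes.comp {ρ : DCube k → DCube l} (hρ : IsCubeMorphism ρ) {c : DCube l → X}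
    (hc : c ∈ Cubes X l) : (fun ω => c (ρ ω)) ∈ Cubes X k :=
  CubeStructure.comp_mem ρ hρ c hc

theorem mem_cubes_zero (c : DCube 0 → X) : c ∈ Cubes X 0 := by
  rw [Cubes, CubeStructure.cubes_zero]
  trivial

theorem const_mem_cubes (k : ℕ) (x : X) : (fun _ => x) ∈ Cubes X k :=
  Cubes.comp (ρ := fun _ => ones 0) (fun i => i.elim0) (mem_cubes_zero fun _ => x)

theorem isCubeMorphism_reindex (σ : Fin l → Fin k) :
    IsCubeMorphism fun (ω : DCube k) i => ω (σ i) :=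
  fun i => Or.inr (Or.inl ⟨σ i, fun _ => rfl⟩)

/-- Fixing some of the coordinates. -/
theorem isCubeMorphism_ite (P : Fin k → Prop) [DecidablePred P] (b : Fin k → Bool) :
    IsCubeMorphism fun (ω : DCube k) i => if P i then b i else ω i := by
  intro i
  by_cases h : P i
  · exact Or.inl ⟨b i, fun x => by simp [h]⟩
  · exact Or.inr (Or.inl ⟨i, fun x => by simp [h]⟩)

theorem isCubeMorphism_inf (η : DCube k) : IsCubeMorphism fun ω : DCube k => ω ⊓ η := by
  intro i
  cases h : η i
  · exact Or.inl ⟨false, fun x => by simp [h]⟩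
  · exact Or.inr (Or.inl ⟨i, fun x => by simp [h]⟩)

/-- The reflection of the cube that moves the vertex `v` to `(1, …, 1)`. -/
def reflect (v ω : DCube k) : DCube k := fun i => if v i = true then ω i else !ω i

theorem isCubeMorphism_reflect (v : DCube k) : IsCubeMorphism (reflect v) := by
  intro i
  cases h : v i
  · exact Or.inr (Or.inr ⟨i, fun x => by simp [reflect, h]⟩)
  · exact Or.inr (Or.inl ⟨i, fun x => by simp [reflect, h]⟩)

@[simp] theorem reflect_reflect (v ω : DCube k) : reflect v (reflect v ω) = ω := by
  funext i
  cases h : v i <;> simp [reflect, h]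

theorem reflect_eq_ones {v ω : DCube k} : reflect v ω = ones k ↔ ω = v := by
  constructor
  · intro h
    funext i
    have := congrFun h i
    cases hv : v i <;> simpa [reflect, ones, hv] using this
  · rintro rfl
    funext i
    cases hv : ω i <;> simp [reflect, ones, hv]

/-- Glueing along an arbitrary coordinate. -/
theorem HasGlueing.glue (hX : HasGlueing X) (i : Fin k) {c c' : DCube k → X}
    (hc : c ∈ Cubes X k) (hc' : c' ∈ Cubes X k)
    (h : ∀ ω, c (Function.update ω i true) = c' (Function.update ω i false)) :
    (fun ω => if ω i = true then c' ω else c ω) ∈ Cubes X k := by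
  obtain _ | n := k
  · exact i.elim0
  have e : ∀ (ω : DCube n) (b : Bool),
      (fun j => Fin.snoc (α := fun _ => Bool) ω b (Equiv.swap i (Fin.last n) j)) =
        Function.update (fun j => Fin.snoc (α := fun _ => Bool) ω true
          (Equiv.swap i (Fin.last n) j)) i b := by
    intro ω b
    funext j
    by_cases hj : j = i
    · subst hj
      simp
    · rw [Function.update_of_ne hj]
      obtain ⟨m, hm⟩ : ∃ m : Fin n, Equiv.swap i (Fin.last n) j = m.castSucc := by
        refine (Fin.eq_castSucc_of_ne_last fun h' => hj ?_).imp fun _ => Eq.symm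
        exact (Equiv.swap i (Fin.last n)).injective
          (h'.trans (Equiv.swap_apply_left i (Fin.last n)).symm)
      rw [hm, Fin.snoc_castSucc, Fin.snoc_castSucc]
  have h1 := hX n _ _ (Cubes.comp (isCubeMorphism_reindex (Equiv.swap i (Fin.last n))) hc)
    (Cubes.comp (isCubeMorphism_reindex (Equiv.swap i (Fin.last n))) hc') (by
      intro ω
      rw [e ω true, e ω false]
      simpa using h (fun j => Fin.snoc (α := fun _ => Bool) ω true
          (Equiv.swap i (Fin.last n) j)))
  have h2 := Cubes.comp (isCubeMorphism_reindex (Equiv.swap i (Fin.last n))) h1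
  simpa using h2

/-- Sets the coordinates in `S` to `1`. -/
def raise (S : Finset (Fin k)) (ω : DCube k) : DCube k := fun i => if i ∈ S then true else ω i

@[simp] theorem raise_empty (ω : DCube k) : raise ∅ ω = ω := by
  funext i
  simp [raise]

theorem isCubeMorphism_raise (S : Finset (Fin k)) : IsCubeMorphism (raise S) :=
  isCubeMorphism_ite (· ∈ S) fun _ => true

/-- If two cubes agree off the upper face `ω_S = 1`, then on this face the second one can be
combined with the retraction of the first one. -/
theorem HasGlueing.upper_face_of_eq (hX : HasGlueing X) (S : Finset (Fin k)) {c c' : DCube k → X}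
    (hc : c ∈ Cubes X k) (hc' : c' ∈ Cubes X k)
    (h : ∀ ω, (¬ ∀ i ∈ S, ω i = true) → c ω = c' ω) :
    (fun ω => if ∀ i ∈ S, ω i = true then c' ω else c (raise S ω)) ∈ Cubes X k := by
  suffices H : ∀ J ⊆ S,
      (fun ω => if ∀ i ∈ S, ω i = true then c' ω else c (raise J ω)) ∈ Cubes X k from H S subset_rfl
  intro J
  induction J using Finset.induction_on with
  | empty =>
    intro _
    convert hc' using 2 with ω
    split_ifs with hω
    · rfl
    · simpa using h ω hω
  | insert j J hj ih =>
    intro hJ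
    have hjS : j ∈ S := hJ (Finset.mem_insert_self j J)
    have hd := ih ((Finset.subset_insert j J).trans hJ)
    -- Flipping `j` puts the `ω_j = 1` half of `c` on the new lower half, which becomes constant in
    -- direction `j` relative to the old upper half. The seam is the old lower half.
    have hm : IsCubeMorphism fun (ω : DCube k) i =>
        if i ∈ J then true else if i = j then !ω i else ω i := by
      intro i
      by_cases h1 : i ∈ J
      · exact Or.inl ⟨true, fun x => by simp [h1]⟩
      by_cases h2 : i = j
      · exact Or.inr (Or.inr ⟨i, fun x => by simp only [if_neg h1, if_pos h2]⟩)
      · exact Or.inr (Or.inl ⟨i, fun x => by simp [h1, h2]⟩)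
    convert hX.glue j (Cubes.comp hm hc) hd ?_ using 2 with ω
    · by_cases hω : ∀ i ∈ S, ω i = true
      · simp only [hω j hjS, if_pos hω, if_true]
      · rw [if_neg hω, if_neg hω]
        by_cases hωj : ω j = true
        · rw [if_pos hωj]
          congr 1
          funext i
          by_cases hij : i = j
          · subst hij
            simp [raise, hωj]
          · simp [raise, hij]
        · rw [if_neg hωj]
          congr 1
          funext i
          by_cases hij : i = j
          · subst hij
            simpa [raise, hj] using hωj
          · simp [raise, hij]
    · intro ω
      rw [if_neg (fun hω => by simpa using hω j hjS)]
      congr 1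
      funext i
      by_cases hij : i = j
      · subst hij
        simp [raise, hj]
      · simp [raise, hij]

/-- If a cube `d` agrees off the upper face `ω_S = 1` with the retraction of a cube `c` to this
face, then on this face `c` can be replaced by `d`. -/
theorem HasGlueing.replace_upper_face (hX : HasGlueing X) (S : Finset (Fin k))
    {c d : DCube k → X} (hc : c ∈ Cubes X k) (hd : d ∈ Cubes X k)
    (h : ∀ ω, (¬ ∀ i ∈ S, ω i = true) → d ω = c (raise S ω)) :
    (fun ω => if ∀ i ∈ S, ω i = true then d ω else c ω) ∈ Cubes X k := by
  suffices H : ∀ J ⊆ S, (fun ω => if ∀ i ∈ S, ω i = true then d ω else c (raise (S \ J) ω)) ∈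
      Cubes X k by
    simpa using H S subset_rfl
  intro J
  induction J using Finset.induction_on with
  | empty =>
    intro _
    convert hd using 2 with ω
    split_ifs with hω
    · rfl
    · simpa using (h ω hω).symm
  | insert j J hj ih =>
    intro hJ
    have hjS : j ∈ S := hJ (Finset.mem_insert_self j J)
    have hd' := ih ((Finset.subset_insert j J).trans hJ)
    -- The new lower half no longer raises `j`; at its face `ω_j = 1` it still matches the lower
    -- half of the previous configuration, where `j` was raised.
    convert hX.glue j (Cubes.comp (isCubeMorphism_raise (S \ insert j J)) hc) hd' ?_ using 2 with ω
    · by_cases hω : ∀ i ∈ S, ω i = true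
      · simp only [hω j hjS, if_pos hω, if_true]
      · rw [if_neg hω, if_neg hω]
        by_cases hωj : ω j = true
        · rw [if_pos hωj]
          congr 1
          funext i
          by_cases hij : i = j
          · subst hij
            simp [raise, hωj]
          · simp [raise, hij]
        · rw [if_neg hωj]
    · intro ω
      rw [if_neg (fun hω => by simpa using hω j hjS)]
      congr 1
      funext i
      by_cases hij : i = j
      · subst hij
        simp [raise, hj, hjS]
      · simp [raise, hij]

end Cubes

/-! ## Lifting partial cubes through fibrations -/

section Lifting

variable {X Z W : Type*} [CubeStructure X] [CubeStructure Z] [CubeStructure W] {k : ℕ}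

theorem inf_ones (ω : DCube k) : ω ⊓ ones k = ω := by
  funext i
  simp [ones]

theorem le_ones (ω : DCube k) : ω ≤ ones k := by
  rw [← inf_eq_left]
  exact inf_ones ω

/-- Composing with the retractions `ω ↦ ω ⊓ η` expresses the corner condition through total
functions and cubes of one fixed dimension, so partial cubes on arbitrary lower sets can be treated
in the same way. -/
theorem isCubeCorner_iff (l : DCube k → X) :
    IsCubeCorner k (fun ω : {ω : DCube k // ω ≠ ones k} => l ω.1) ↔
      ∀ η, η ≠ ones k → (fun ω => l (ω ⊓ η)) ∈ Cubes X k := by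
  obtain _ | n := k
  · simp only [IsCubeCorner, true_iff]
    intro η h
    exact (h (Subsingleton.elim _ _)).elim
  have hins : ∀ i : Fin (n + 1), IsCubeMorphism fun ω : DCube n =>
      (i.insertNth (α := fun _ => Bool) false ω : DCube (n + 1)) := by
    intro i j
    refine Fin.succAboveCases i ?_ (fun m => ?_) j
    · exact Or.inl ⟨false, fun x => by simp⟩
    · exact Or.inr (Or.inl ⟨m, fun x => by simp⟩)
  constructor
  · intro h η hη
    obtain ⟨i, hi⟩ : ∃ i, η i = false := by
      by_contra hcon
      exact hη (funext fun i => by simpa [ones] using not_exists.1 hcon i)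
    have hm : IsCubeMorphism fun (ω : DCube (n + 1)) (j : Fin n) => (ω ⊓ η) (i.succAbove j) :=
      fun j => isCubeMorphism_inf η (i.succAbove j)
    convert Cubes.comp hm (h i) using 3 with ω
    funext j
    refine Fin.succAboveCases i ?_ (fun m => ?_) j
    · simp [hi]
    · simp
  · intro h i
    convert Cubes.comp (hins i) (h (i.insertNth (α := fun _ => Bool) false (ones n))
      (insertNth_false_ne_ones i _)) using 3 with ω
    funext j
    refine Fin.succAboveCases i ?_ (fun m => ?_) j
    · simp
    · simp [ones]

/-- The lower face `{η : η ≤ ω}`, with its parametrization and the retraction to it. -/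
theorem exists_lower_face (ω : DCube k) : ∃ (e : DCube (Fintype.card {i // ω i = true}) → DCube k)
    (r : DCube k → DCube (Fintype.card {i // ω i = true})), IsCubeMorphism e ∧ IsCubeMorphism r ∧
      (∀ η, e (r η) = η ⊓ ω) ∧ (∀ ξ, r (e ξ) = ξ) ∧ (∀ ξ ξ', e (ξ ⊓ ξ') = e ξ ⊓ e ξ') ∧
      r ω = ones _ := by
  classical
  let ι := Fintype.equivFin {i // ω i = true}
  refine ⟨fun ξ i => if h : ω i = true then ξ (ι ⟨i, h⟩) else false, fun η j => η (ι.symm j).1,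
    ?_, isCubeMorphism_reindex _, ?_, ?_, ?_, funext fun j => (ι.symm j).2⟩
  · intro i
    by_cases h : ω i = true
    · exact Or.inr (Or.inl ⟨ι ⟨i, h⟩, fun x => by simp [h]⟩)
    · exact Or.inl ⟨false, fun x => by simp [h]⟩
  · intro η
    funext i
    cases h : ω i <;> simp [h]
  · intro ξ
    funext j
    have := (ι.symm j).2
    simp [this]
  · intro ξ ξ'
    funext i
    cases h : ω i <;> simp [h]

variable [TopologicalSpace Z] [TopologicalSpace W]

/-- The vertices strictly below `ω` form a corner of the face below `ω`. It is completed there by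
the fibration property and spread over the whole cube by the retraction. -/
theorem IsFibration.exists_extension_at {g : Z → W} (hg : IsFibration g) {c : DCube k → W}
    {l : DCube k → Z} (ω : DCube k) (hc : (fun η => c (η ⊓ ω)) ∈ Cubes W k)
    (hl : ∀ η < ω, (fun ξ => l (ξ ⊓ η)) ∈ Cubes Z k) (hgl : ∀ η < ω, g (l η) = c η) :
    ∃ d ∈ Cubes Z k, (∀ η < ω, d η = l η) ∧ (∀ η, d η = d (η ⊓ ω)) ∧
      ∀ η, g (d η) = c (η ⊓ ω) := by
  obtain ⟨e, r, he, hr, her, hre, hinf, hrω⟩ := exists_lower_face ω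
  have hle : ∀ ξ, e ξ ≤ ω := fun ξ => by
    rw [← inf_eq_left, ← her, hre]
  have hlt : ∀ ξ, ξ ≠ ones _ → e ξ < ω := by
    refine fun ξ hξ => lt_of_le_of_ne (hle ξ) fun h => hξ ?_
    rw [← hre ξ, h, hrω]
  obtain ⟨c', hc', h1, h2⟩ := hg.lift _ (fun ξ => c (e ξ))
    (by
      convert Cubes.comp he hc using 3 with ξ
      rw [inf_eq_left.2 (hle ξ)])
    (fun ξ => l (e ξ.1))
    ((isCubeCorner_iff fun ξ => l (e ξ)).2 fun η hη => by
      convert Cubes.comp he (hl (e η) (hlt η hη)) using 3 with ξ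
      rw [hinf])
    (fun ξ => hgl _ (hlt _ ξ.2))
  refine ⟨fun η => c' (r η), Cubes.comp hr hc', ?_, ?_, ?_⟩
  · intro η hη
    have hη' : e (r η) = η := by rw [her, inf_eq_left.2 hη.le]
    refine (h1 ⟨r η, fun h => hη.ne ?_⟩).trans (congrArg l hη')
    rw [← hη', h, ← hrω, her, inf_idem]
  · intro η
    change c' (r η) = c' (r (η ⊓ ω))
    rw [← her, hre]
  · intro η
    rw [← her]
    exact congrFun h2 _

theorem IsFibration.surjective {g : Z → W} (hg : IsFibration g) : Function.Surjective g := by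
  intro w
  obtain ⟨c, -, -, hc⟩ := hg.lift 0 (fun _ => w) (mem_cubes_zero _)
    (fun ω => (ω.2 (Subsingleton.elim _ _)).elim) trivial
    (fun ω => (ω.2 (Subsingleton.elim _ _)).elim)
  exact ⟨c (ones 0), congrFun hc _⟩

/-- Partial cubes on lower sets can be lifted, and partial lifts can be extended. -/
theorem IsFibration.exists_extension {g : Z → W} (hg : IsFibration g) {D D₀ : Set (DCube k)}
    (hD : IsLowerSet D) {c : DCube k → W}
    (hc : ∀ ω ∈ D, (fun η => c (η ⊓ ω)) ∈ Cubes W k) (l : DCube k → Z) (hD₀ : IsLowerSet D₀)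
    (hl : ∀ ω ∈ D₀, (fun η => l (η ⊓ ω)) ∈ Cubes Z k) (hgl : ∀ ω ∈ D₀, g (l ω) = c ω) :
    ∃ l' : DCube k → Z, (∀ ω ∈ D₀, l' ω = l ω) ∧
      ∀ ω ∈ D, (fun η => l' (η ⊓ ω)) ∈ Cubes Z k ∧ g (l' ω) = c ω := by
  classical
  induction hn : (D \ D₀).ncard using Nat.strong_induction_on generalizing D₀ l with
  | _ n ih =>
    by_cases hne : (D \ D₀).Nonempty
    -- By minimality everything strictly below `ω` is already lifted, so one corner completion adds
    -- `ω` to the domain.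
    · obtain ⟨ω, hω⟩ := (D \ D₀).toFinite.exists_minimal hne
      have hlt : ∀ η < ω, η ∈ D₀ := fun η hη => by
        by_contra hη'
        exact hη.not_ge (hω.le_of_le ⟨hD hη.le hω.prop.1, hη'⟩ hη.le)
      obtain ⟨d, hd, hd1, hd2, hd3⟩ := hg.exists_extension_at ω (hc ω hω.prop.1)
        (fun η hη => hl η (hlt η hη)) (fun η hη => hgl η (hlt η hη))
      have hup : ∀ η ≤ ω, Function.update l ω (d ω) η = d η := by
        intro η hη
        rcases hη.eq_or_lt with rfl | h
        · simp
        · rw [Function.update_of_ne h.ne, hd1 η h]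
      have hlow : IsLowerSet (insert ω D₀) := by
        rintro η ξ hξ (rfl | h)
        · rcases hξ.eq_or_lt with rfl | h
          · exact mem_insert _ _
          · exact Or.inr (hlt _ h)
        · exact Or.inr (hD₀ hξ h)
      have hold : ∀ η ∈ D₀, Function.update l ω (d ω) η = l η := fun η hη =>
        Function.update_of_ne (fun h : η = ω => hω.prop.2 (h ▸ hη)) _ _
      obtain ⟨l', h1, h2⟩ := ih (D \ insert ω D₀).ncard (by
          rw [← hn]
          refine ncard_lt_ncard ⟨fun η hη => ⟨hη.1, fun h => hη.2 (Or.inr h)⟩, fun h => ?_⟩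
          exact (h hω.prop).2 (mem_insert _ _)) (Function.update l ω (d ω)) hlow
        (by
          rintro η (rfl | h)
          · convert hd using 2 with ξ
            rw [hup _ inf_le_right, ← hd2]
          · convert hl η h using 2 with ξ
            exact hold _ (hD₀ inf_le_right h))
        (by
          rintro η (rfl | h)
          · rw [hup _ le_rfl, hd3, inf_idem]
          · rw [hold η h, hgl η h]) rfl
      exact ⟨l', fun η hη => (h1 η (Or.inr hη)).trans (hold η hη), h2⟩
    · have hDD : D ⊆ D₀ := fun ω hω => by
        by_contra h
        exact hne ⟨ω, hω, h⟩
      exact ⟨l, fun _ _ => rfl, fun ω hω => ⟨hl ω (hDD hω), hgl ω (hDD hω)⟩⟩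

theorem mem_cubes_of_le_ones {l : DCube k → X}
    (h : (fun η => l (η ⊓ ones k)) ∈ Cubes X k) : l ∈ Cubes X k := by
  simpa only [inf_ones] using h

theorem IsFibration.exists_cube_lift {g : Z → W} (hg : IsFibration g) {D₀ : Set (DCube k)}
    {c : DCube k → W} (hc : c ∈ Cubes W k) (l : DCube k → Z) (hD₀ : IsLowerSet D₀)
    (hl : ∀ ω ∈ D₀, (fun η => l (η ⊓ ω)) ∈ Cubes Z k) (hgl : ∀ ω ∈ D₀, g (l ω) = c ω) :
    ∃ l' ∈ Cubes Z k, (∀ ω ∈ D₀, l' ω = l ω) ∧ g ∘ l' = c := by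
  obtain ⟨l', h1, h2⟩ := hg.exists_extension (D := univ) (fun _ _ _ _ => trivial)
    (fun ω _ => Cubes.comp (isCubeMorphism_inf ω) hc) l hD₀ hl hgl
  exact ⟨l', mem_cubes_of_le_ones (h2 (ones k) trivial).1, h1, funext fun ω => (h2 ω trivial).2⟩

theorem IsFibration.exists_lift {g : Z → W} (hg : IsFibration g) {c : DCube k → W}
    (hc : c ∈ Cubes W k) : ∃ l ∈ Cubes Z k, g ∘ l = c := by
  choose q hq using hg.surjective
  obtain ⟨l, h1, -, h2⟩ := hg.exists_cube_lift (D₀ := ∅) hc (fun ω => q (c ω))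
    (fun _ _ _ h => h) (fun _ h => h.elim) (fun _ h => h.elim)
  exact ⟨l, h1, h2⟩

/-- The second cube is lifted so as to extend the upper face of a lift of the first one; then the
lifts are glued upstairs and pushed down. -/
theorem IsFibration.hasGlueing {p : Z → W} (hp : IsFibration p) (hZ : HasGlueing Z) :
    HasGlueing W := by
  intro n c c' hc hc' h
  obtain ⟨d, hd, rfl⟩ := hp.exists_lift hc
  have hm : IsCubeMorphism fun ω : DCube (n + 1) =>
      (Fin.snoc (α := fun _ => Bool) (Fin.init ω) true : DCube (n + 1)) := by
    intro i
    refine Fin.lastCases ?_ (fun j => ?_) i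
    · exact Or.inl ⟨true, fun x => by simp⟩
    · exact Or.inr (Or.inl ⟨j.castSucc, fun x => by simp [Fin.init]⟩)
  obtain ⟨d', hd', h1, rfl⟩ := hp.exists_cube_lift (D₀ := {ω | ω (Fin.last n) = false}) hc'
    (fun ω => d (Fin.snoc (α := fun _ => Bool) (Fin.init ω) true))
    (fun ω η hη (hω : ω _ = false) => by
      have := hη (Fin.last n)
      rw [hω] at this
      exact le_bot_iff.1 this)
    (fun ω hω => Cubes.comp (isCubeMorphism_inf ω) (Cubes.comp hm hd))
    (fun ω hω => by
      refine (h (Fin.init ω)).trans ?_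
      congr 1
      rw [← (hω : ω (Fin.last n) = false), Fin.snoc_init_self])
  have := hp.map_cubes _ _ (hZ n d d' hd hd' fun ω => by
    rw [h1 _ (by simp)]
    simp)
  convert this using 2 with ω
  by_cases hω : ω (Fin.last n) = true <;> simp [hω]

variable [TopologicalSpace X]

/-- A corner of `Z` lifts through `p` because its vertices form a lower set; the lift is completed
by the fibration `g ∘ p` and mapped back to `Z`. -/
theorem IsFibration.of_comp {g : Z → W} {p : X → Z} (hgp : IsFibration (g ∘ p))
    (hp : IsFibration p) (hg : Continuous g) : IsFibration g where
  continuous := hg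
  map_cubes k c hc := by
    obtain ⟨d, hd, rfl⟩ := hp.exists_lift hc
    exact hgp.map_cubes k d hd
  lift k c hc l hl hgl := by
    classical
    choose q hq using hp.surjective
    choose q' hq' using hgp.surjective
    let l₀ : DCube k → Z := fun ω => if h : ω ≠ ones k then l ⟨ω, h⟩ else p (q' (c ω))
    have hl₀ : ∀ ω (h : ω ≠ ones k), l₀ ω = l ⟨ω, h⟩ := fun ω h => dif_pos h
    have hle : l = fun ω => l₀ ω.1 := funext fun ω => (hl₀ ω.1 ω.2).symm
    rw [hle, isCubeCorner_iff] at hl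
    have hlow : IsLowerSet {ω : DCube k | ω ≠ ones k} := fun ω η hη hω h =>
      hω (le_antisymm (le_ones ω) (h ▸ hη))
    obtain ⟨m, -, hm⟩ := hp.exists_extension (D := {ω | ω ≠ ones k}) (D₀ := ∅) hlow hl
      (fun ω => q (l₀ ω)) (fun _ _ _ h => h) (fun _ h => h.elim) (fun _ h => h.elim)
    obtain ⟨c', h1, h2, h3⟩ := hgp.lift k c hc (fun ω => m ω.1)
      ((isCubeCorner_iff m).2 fun η hη => (hm η hη).1)
      (fun ω => by rw [Function.comp_apply, (hm ω.1 ω.2).2, hl₀ ω.1 ω.2, hgl])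
    refine ⟨p ∘ c', hp.map_cubes k c' h1, fun ω => ?_, h3⟩
    rw [Function.comp_apply, h2 ω, (hm ω.1 ω.2).2, hl₀ ω.1 ω.2]

end Lifting

/-! ## The canonical relations -/

theorem continuous_cornerConfig {X : Type*} [TopologicalSpace X] (k : ℕ) :
    Continuous fun p : X × X => cornerConfig k p.1 p.2 := by
  refine continuous_pi fun ω => ?_
  by_cases h : ω = ones k
  · simpa [cornerConfig, h] using continuous_snd
  · simpa [cornerConfig, h] using continuous_fst

section CanonRel

variable {X : Type u} {Y : Type v} [CubeStructure X] {k : ℕ}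

theorem forall_mem_univ_eq_true {ω : DCube k} :
    (∀ i ∈ (Finset.univ : Finset (Fin k)), ω i = true) ↔ ω = ones k :=
  ⟨fun h => funext fun i => h i (Finset.mem_univ i), fun h i _ => congrFun h i⟩

theorem raise_univ (ω : DCube k) : raise Finset.univ ω = ones k := by
  funext i
  simp [raise, ones]

theorem HasGlueing.cornerConfig_mem (hX : HasGlueing X) {c c' : DCube k → X}
    (hc : c ∈ Cubes X k) (hc' : c' ∈ Cubes X k) (h : ∀ ω, ω ≠ ones k → c ω = c' ω) :
    cornerConfig k (c (ones k)) (c' (ones k)) ∈ Cubes X k := by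
  convert hX.upper_face_of_eq Finset.univ hc hc'
    (fun ω hω => h ω fun h' => hω (forall_mem_univ_eq_true.2 h')) using 2 with ω
  simp only [forall_mem_univ_eq_true, raise_univ, cornerConfig]
  split_ifs with h
  · rw [h]
  · rfl

/-- After a reflection `v` is the top vertex, and the corner configuration is glued in along all
coordinates at once. -/
theorem HasGlueing.update_mem (hX : HasGlueing X) {c : DCube k → X} (hc : c ∈ Cubes X k)
    (v : DCube k) {x : X} (hx : cornerConfig k (c v) x ∈ Cubes X k) :
    Function.update c v x ∈ Cubes X k := by
  have hv : reflect v (ones k) = v := by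
    rw [← reflect_eq_ones.2 (rfl : v = v), reflect_reflect]
  have := hX.replace_upper_face Finset.univ (Cubes.comp (isCubeMorphism_reflect v) hc) hx
    fun ω hω => by
      rw [forall_mem_univ_eq_true] at hω
      rw [raise_univ, hv, cornerConfig, if_neg hω]
  convert Cubes.comp (isCubeMorphism_reflect v) this using 2 with ω
  simp only [forall_mem_univ_eq_true, reflect_eq_ones, cornerConfig, reflect_reflect]
  by_cases h : ω = v
  · subst h
    simp
  · simp [h]

/-- The witnessing cubes can be glued until all vertices off the top carry the value `x`. No
existential quantifier is left, which is what makes closedness and transitivity visible. -/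
theorem canonRel_iff (hX : HasGlueing X) {f : X → Y} {s : ℕ} {x x' : X} :
    CanonRel f s x x' ↔ f x = f x' ∧ cornerConfig (s + 1) x x' ∈ Cubes X (s + 1) := by
  constructor
  · intro h
    refine ⟨h.map_eq, ?_⟩
    obtain ⟨c, hc, c', hc', -, rfl, rfl, h⟩ := h
    exact hX.cornerConfig_mem hc hc' h
  · rintro ⟨h1, h2⟩
    refine ⟨fun _ => x, const_mem_cubes _ x, _, h2, ?_, rfl, by simp [cornerConfig],
      fun ω hω => by simp [cornerConfig, hω]⟩
    funext ω
    by_cases h : ω = ones (s + 1) <;> simp [cornerConfig, h, h1]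

theorem CanonRel.mono {f : X → Y} {i j : ℕ} (hij : i ≤ j) {x x' : X} (h : CanonRel f j x x') :
    CanonRel f i x x' := by
  induction j, hij using Nat.le_induction with
  | base => exact h
  | succ j _ ih => exact ih h.pred

theorem CanonRel.cornerConfig_mem (hX : HasGlueing X) {f : X → Y} {s : ℕ} {x x' : X}
    (h : CanonRel f s x x') (hk : k ≤ s + 1) : cornerConfig k x x' ∈ Cubes X k := by
  obtain _ | n := k
  · exact mem_cubes_zero _
  · exact ((canonRel_iff hX).1 (h.mono (Nat.le_of_succ_le_succ hk))).2

/-- Universal replacement: in cubes of dimension at most `s + 1`, vertices can be replaced by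
`∼_{f,s}`-equivalent ones. -/
theorem CanonRel.replace (hX : HasGlueing X) {f : X → Y} {s : ℕ} (hk : k ≤ s + 1)
    {c c' : DCube k → X} (hc : c ∈ Cubes X k) (h : ∀ ω, CanonRel f s (c ω) (c' ω)) :
    c' ∈ Cubes X k := by
  suffices H : ∀ V : Finset (DCube k), (fun ω => if ω ∈ V then c' ω else c ω) ∈ Cubes X k by
    simpa using H Finset.univ
  intro V
  induction V using Finset.induction_on with
  | empty => simpa using hc
  | insert v V hv ih =>
    convert hX.update_mem ih v (x := c' v) ?_ using 1
    · funext ω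
      by_cases hω : ω = v
      · subst hω
        simp
      · simp [hω]
    · simpa [hv] using (h v).cornerConfig_mem hX hk

theorem canonRel_equivalence (hX : HasGlueing X) (f : X → Y) (s : ℕ) :
    Equivalence (CanonRel f s) where
  refl x := (canonRel_iff hX).2 ⟨rfl, by
    convert const_mem_cubes (s + 1) x using 2
    simp [cornerConfig]⟩
  symm := by
    rintro x y ⟨c, hc, c', hc', h1, h2, h3, h4⟩
    exact ⟨c', hc', c, hc, h1.symm, h3, h2, fun ω hω => (h4 ω hω).symm⟩
  trans := by
    intro x y z hxy hyz
    rw [canonRel_iff hX] at hxy hyz ⊢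
    refine ⟨hxy.1.trans hyz.1, ?_⟩
    -- Transitivity: the top vertex `y` of `⌞(x; y)` is replaced by `z`.
    convert hX.update_mem hxy.2 (ones _) (x := z) (by simpa [cornerConfig] using hyz.2) using 1
    funext ω
    by_cases h : ω = ones (s + 1)
    · subst h
      simp [cornerConfig]
    · simp [cornerConfig, h]

theorem proj_eq_iff (hX : HasGlueing X) {f : X → Y} {s : ℕ} {x x' : X} :
    proj f s x = proj f s x' ↔ CanonRel f s x x' :=
  ⟨fun h => (canonRel_equivalence hX f s).quot_mk_eq_iff x x' |>.1 h, fun h => Quot.sound h⟩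

/-- Restriction to the upper face of dimension `m` (in the coordinates listed by `σ`). -/
theorem exists_upper_face {m : ℕ} (hm : m ≤ k) : ∃ e : DCube m → DCube k,
    IsCubeMorphism e ∧ ∀ ξ, e ξ = ones k ↔ ξ = ones m := by
  refine ⟨fun ξ i => if h : i.1 < m then ξ ⟨i, h⟩ else true, ?_, ?_⟩
  · intro i
    by_cases h : i.1 < m
    · exact Or.inr (Or.inl ⟨⟨i, h⟩, fun x => by simp [h]⟩)
    · exact Or.inl ⟨true, fun x => by simp [h]⟩
  · refine fun ξ => ⟨fun h => ?_, ?_⟩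
    · funext i
      simpa [ones] using congrFun h (Fin.castLE hm i)
    · rintro rfl
      funext i
      simp [ones]

theorem relUniqueness_mono {f : X → Y} {m : ℕ} (hm : m ≤ k) (h : RelUniqueness f m) :
    RelUniqueness f k := by
  intro c hc c' hc' hf hω
  obtain ⟨e, he, he1⟩ := exists_upper_face hm
  funext ω
  by_cases hne : ω = ones k
  · have := h _ (Cubes.comp he hc) _ (Cubes.comp he hc') (funext fun ξ => congrFun hf (e ξ))
      fun ξ hξ => hω _ fun h' => hξ ((he1 ξ).1 h')
    rw [hne, ← (he1 _).2 rfl]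
    exact congrFun this _
  · exact hω ω hne

theorem DegreeAtMost.relUniqueness {f : X → Y} {s : ℕ} (h : DegreeAtMost f s) :
    RelUniqueness f (s + 1) := by
  obtain ⟨k, hk, h⟩ := h
  exact relUniqueness_mono hk h

/-- Cubes with equal images in `Y` whose vertices off the top are equivalent have equivalent top
vertices. -/
theorem canonRel_ones (hX : HasGlueing X) {f : X → Y} {s : ℕ} (hk : s + 1 ≤ k)
    {c c' : DCube k → X} (hc : c ∈ Cubes X k) (hc' : c' ∈ Cubes X k) (hf : f ∘ c = f ∘ c')
    (h : ∀ ω, ω ≠ ones k → CanonRel f s (c ω) (c' ω)) :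
    CanonRel f s (c (ones k)) (c' (ones k)) := by
  obtain ⟨e, he, he1⟩ := exists_upper_face hk
  have htop := (he1 _).2 rfl
  -- On an upper `(s+1)`-face, the vertices of `c` off the top are exchanged for those of `c'`. The
  -- result and `c'` then witness the relation directly.
  let d : DCube (s + 1) → X := fun ξ => if ξ = ones (s + 1) then c (ones k) else c' (e ξ)
  have hd : d ∈ Cubes X (s + 1) := by
    refine CanonRel.replace hX (f := f) le_rfl (Cubes.comp he hc) fun ξ => ?_
    by_cases hξ : ξ = ones (s + 1)
    · subst hξ
      rw [htop]
      simpa [d] using (canonRel_equivalence hX f s).refl _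
    · simpa [d, hξ] using h _ fun h' => hξ ((he1 ξ).1 h')
  refine ⟨d, hd, _, Cubes.comp he hc', ?_, by simp [d], by rw [htop], fun ξ hξ => by simp [d, hξ]⟩
  funext ξ
  by_cases hξ : ξ = ones (s + 1)
  · subst hξ
    simpa [d, htop] using congrFun hf (ones k)
  · simp [d, hξ]

/-! ### Degree, ergodicity and injectivity of the maps in the tower. -/

theorem relUniqueness_toBase (hXg : HasGlueing X) (f : X → Y) (s : ℕ) :
    RelUniqueness (toBase f s) (s + 1) := by
  rintro _ ⟨c, hc, rfl⟩ _ ⟨c', hc', rfl⟩ hf h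
  have h' : ∀ ω, ω ≠ ones (s + 1) → CanonRel f s (c ω) (c' ω) :=
    fun ω hω => (proj_eq_iff hXg).1 (h ω hω)
  funext ω
  by_cases hω : ω = ones (s + 1)
  · subst hω
    exact Quot.sound (canonRel_ones hXg le_rfl hc hc' hf h')
  · exact h ω hω

theorem toBase_comp_step (f : X → Y) (i : ℕ) : toBase f i ∘ step f i = toBase f (i + 1) := by
  funext z
  obtain ⟨x, rfl⟩ := Quot.exists_rep z
  rfl

theorem degreeAtMost_step (hXg : HasGlueing X) (f : X → Y) (i : ℕ) :
    DegreeAtMost (step f i) (i + 1) := by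
  refine ⟨_, le_rfl, fun c hc c' hc' h => relUniqueness_toBase hXg f (i + 1) c hc c' hc' ?_⟩
  rw [← toBase_comp_step, Function.comp_assoc, h, Function.comp_assoc]

/-- Any vertexwise lift of the configuration to `X` is `∼_{f,i}`-equivalent to a genuine cube, and
in dimension at most `i + 1` replacement makes the lift itself a cube. -/
theorem relErgodic_step (hXg : HasGlueing X) (f : X → Y) (i : ℕ) :
    RelErgodic (step f i) (i + 1) := by
  rintro l - hl c ⟨d, hd, hdc⟩
  choose q hq using fun z : Factor f (i + 1) => Quot.exists_rep z
  refine ⟨q ∘ c, CanonRel.replace hXg (f := f) hl hd fun ω => ?_, funext fun ω => hq _⟩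
  rw [← proj_eq_iff hXg]
  refine (congrFun hdc ω).trans ?_
  change step f i (c ω) = _
  conv_lhs => rw [← hq (c ω)]
  rfl

theorem isErgodic_quot (hXe : IsErgodic X) (r : X → X → Prop) : IsErgodic (Quot r) := by
  refine eq_univ_of_forall fun c => ?_
  choose q hq using fun z : Quot r => Quot.exists_rep z
  refine ⟨q ∘ c, ?_, funext fun ω => hq _⟩
  have h : Cubes X 1 = univ := hXe
  change q ∘ c ∈ Cubes X 1
  rw [h]
  trivial

theorem injective_toBase_zero (hXe : IsErgodic X) (f : X → Y) :
    Function.Injective (toBase f 0) := by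
  intro z z' h
  obtain ⟨x, rfl⟩ := Quot.exists_rep z
  obtain ⟨x', rfl⟩ := Quot.exists_rep z'
  have he : Cubes X 1 = univ := hXe
  have hxx : f x = f x' := h
  refine Quot.sound ⟨fun _ => x, const_mem_cubes _ _, cornerConfig 1 x x', ?_, ?_, rfl, ?_, ?_⟩
  · rw [he]
    trivial
  · funext ω
    by_cases hω : ω = ones 1 <;> simp [cornerConfig, hω, hxx]
  · simp [cornerConfig]
  · intro ω hω
    simp [cornerConfig, hω]

theorem injective_proj (hXg : HasGlueing X) {f : X → Y} {s : ℕ} (hs : DegreeAtMost f s) :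
    Function.Injective (proj f s) := by
  intro x x' h
  obtain ⟨c, hc, c', hc', h1, rfl, rfl, h2⟩ := (proj_eq_iff hXg).1 h
  exact congrFun (hs.relUniqueness c hc c' hc' h1 h2) _

/-! ### Topology of the factors and the fibration property. -/

variable [TopologicalSpace X] [TopologicalSpace Y]

theorem isClosed_canonRel (hX : IsCompactCubespace X) (hXg : HasGlueing X) [T2Space Y]
    {f : X → Y} (hf : Continuous f) (s : ℕ) : IsClosed {p : X × X | CanonRel f s p.1 p.2} := by
  simp only [canonRel_iff hXg]
  exact (isClosed_eq (hf.comp continuous_fst) (hf.comp continuous_snd)).inter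
    ((hX.closed (s + 1)).preimage (continuous_cornerConfig (s + 1)))

theorem isCompactCubespace_quot (hX : IsCompactCubespace X) {r : X → X → Prop}
    (hr : Equivalence r) (hcl : IsClosed {p : X × X | r p.1 p.2}) :
    IsCompactCubespace (Quot r) := by
  have := hX.compact
  have := hX.metrizable
  have : T2Space (Quot r) := t2Space_of_isClosed_ker isQuotientMap_quot_mk (by
    simpa only [hr.quot_mk_eq_iff] using hcl)
  refine ⟨inferInstance,
    metrizableSpace_of_continuous_surjective continuous_quot_mk Quot.mk_surjective, fun k => ?_⟩
  have hc : Continuous fun c : DCube k → X => Quot.mk r ∘ c :=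
    continuous_pi fun ω => continuous_quot_mk.comp (continuous_apply ω)
  exact ((hX.closed k).isCompact.image hc).isClosed

variable [CubeStructure Y]

/-- For `k ≤ s + 1` the corner together with the top vertex of `c` is already a cube, by
replacement. For larger `k` the corner is completed over `f ∘ c`, and `canonRel_ones` shows that the
top vertex lands in the right class. -/
theorem isFibration_proj (hXg : HasGlueing X) {f : X → Y} (hf : IsFibration f) (s : ℕ) :
    IsFibration (proj f s) where
  continuous := continuous_quot_mk
  map_cubes k c hc := ⟨c, hc, rfl⟩
  lift := by
    rintro k _ ⟨c, hc, rfl⟩ l hl hlc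
    have hrel : ∀ ω, CanonRel f s (l ω) (c ω.1) := fun ω => (proj_eq_iff hXg).1 (hlc ω)
    rcases le_or_gt k (s + 1) with hk | hk
    · let d : DCube k → X := fun ω => if h : ω ≠ ones k then l ⟨ω, h⟩ else c ω
      have hd : ∀ ω, CanonRel f s (c ω) (d ω) := fun ω => by
        by_cases h : ω = ones k
        · subst h
          simpa [d] using (canonRel_equivalence hXg f s).refl _
        · simpa [d, h] using (canonRel_equivalence hXg f s).symm (hrel ⟨ω, h⟩)
      refine ⟨d, CanonRel.replace hXg hk hc hd, fun ω => dif_pos ω.2, funext fun ω => ?_⟩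
      exact ((proj_eq_iff hXg).2 (hd ω)).symm
    · obtain ⟨c', hc', h1, h2⟩ := hf.lift k (f ∘ c) (hf.map_cubes k c hc) l hl
        fun ω => (hrel ω).map_eq
      refine ⟨c', hc', h1, funext fun ω => (proj_eq_iff hXg).2 ?_⟩
      by_cases h : ω = ones k
      · subst h
        exact canonRel_ones hXg hk.le hc' hc h2 fun ω hω => by
          rw [h1 ⟨ω, hω⟩]
          exact hrel ⟨ω, hω⟩
      · rw [h1 ⟨ω, h⟩]
        exact hrel ⟨ω, h⟩

theorem isFibration_toBase (hXg : HasGlueing X) {f : X → Y} (hf : IsFibration f) (s : ℕ) :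
    IsFibration (toBase f s) :=
  IsFibration.of_comp (p := proj f s) hf (isFibration_proj hXg hf s)
    (continuous_quot_lift _ hf.continuous)

theorem isFibration_step (hXg : HasGlueing X) {f : X → Y} (hf : IsFibration f) (i : ℕ) :
    IsFibration (step f i) :=
  IsFibration.of_comp (p := proj f (i + 1)) (isFibration_proj hXg hf i)
    (isFibration_proj hXg hf (i + 1)) (continuous_quot_lift _ continuous_quot_mk)

theorem isCubespaceIso_of_injective {Z : Type*} {W : Type*} [TopologicalSpace Z]
    [TopologicalSpace W] [CubeStructure Z] [CubeStructure W] [CompactSpace Z] [T2Space W]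
    {g : Z → W} (hg : IsFibration g) (hinj : Function.Injective g) : IsCubespaceIso g where
  homeo := isHomeomorph_iff_continuous_bijective.2 ⟨hg.continuous, hinj, hg.surjective⟩
  cubes_iff k c := by
    refine ⟨fun h => ?_, hg.map_cubes k c⟩
    obtain ⟨d, hd, hdc⟩ := hg.exists_lift h
    rwa [← hinj.comp_left hdc]

end CanonRel

/-! ## Relatively ergodic fibrations of bounded degree: translations of the fibres -/

/-- The configuration `[⌞^s(x; x'), ⌞^s(y; y')]` is a cube. -/
def Transport {Z : Type u} [CubeStructure Z] (s : ℕ) (x x' y y' : Z) : Prop :=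
  pairConfig (cornerConfig s x x') (cornerConfig s y y') ∈ Cubes Z (s + 1)

theorem pairConfig_cornerConfig {Z : Type u} (s : ℕ) (x x' y y' : Z) (ω : DCube (s + 1)) :
    pairConfig (cornerConfig s x x') (cornerConfig s y y') ω =
      if Fin.init ω = ones s then (if ω (Fin.last s) = true then y' else x')
      else (if ω (Fin.last s) = true then y else x) := by
  simp only [pairConfig, cornerConfig]
  split_ifs <;> rfl

theorem pairConfig_cornerConfig_ones {Z : Type u} (s : ℕ) (x x' y y' : Z) :
    pairConfig (cornerConfig s x x') (cornerConfig s y y') (ones (s + 1)) = y' := by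
  rw [pairConfig_cornerConfig]
  exact (if_pos rfl).trans (if_pos rfl)

theorem init_eq_ones_and_last_iff {s : ℕ} {ω : DCube (s + 1)} :
    Fin.init ω = ones s ∧ ω (Fin.last s) = true ↔ ω = ones (s + 1) := by
  constructor
  · rintro ⟨h1, h2⟩
    rw [← Fin.snoc_init_self ω, h1, h2]
    funext i
    refine Fin.lastCases ?_ (fun j => ?_) i <;> simp [ones]
  · rintro rfl
    exact ⟨rfl, rfl⟩

theorem pairConfig_cornerConfig_congr {Z : Type u} {s : ℕ} (x x' y y' y'' : Z)
    {ω : DCube (s + 1)} (hω : ω ≠ ones (s + 1)) :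
    pairConfig (cornerConfig s x x') (cornerConfig s y y') ω =
      pairConfig (cornerConfig s x x') (cornerConfig s y y'') ω := by
  have hω := mt init_eq_ones_and_last_iff.1 hω
  rw [not_and] at hω
  rw [pairConfig_cornerConfig, pairConfig_cornerConfig]
  split_ifs with h3 h4
  exacts [(hω h3 h4).elim, rfl, rfl, rfl]

theorem continuous_pairConfig_cornerConfig (Z : Type u) [TopologicalSpace Z] (s : ℕ) :
    Continuous fun p : (Z × Z) × Z × Z =>
      pairConfig (cornerConfig s p.1.1 p.1.2) (cornerConfig s p.2.1 p.2.2) := by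
  refine continuous_pi fun ω => ?_
  simp only [pairConfig_cornerConfig]
  split_ifs <;> fun_prop

theorem init_eq_ones_iff {s : ℕ} {ω : DCube (s + 1)} :
    Fin.init ω = ones s ↔ ∀ i ∈ Finset.univ.erase (Fin.last s), ω i = true := by
  constructor
  · intro h i hi
    obtain ⟨j, rfl⟩ := Fin.exists_castSucc_eq.2 (Finset.ne_of_mem_erase hi)
    exact congrFun h j
  · intro h
    funext j
    exact h _ (Finset.mem_erase.2 ⟨(Fin.castSucc_lt_last j).ne, Finset.mem_univ _⟩)

theorem init_raise {s : ℕ} (ω : DCube (s + 1)) :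
    Fin.init (raise (Finset.univ.erase (Fin.last s)) ω) = ones s := by
  funext j
  simp [Fin.init, raise, ones, (Fin.castSucc_lt_last j).ne]

theorem raise_last {s : ℕ} (ω : DCube (s + 1)) :
    raise (Finset.univ.erase (Fin.last s)) ω (Fin.last s) = ω (Fin.last s) := by
  simp [raise]

/-- The fibrations that arise as steps of the tower. -/
structure IsErgodicStep {Z : Type u} {W : Type v} [TopologicalSpace Z] [TopologicalSpace W]
    [CubeStructure Z] [CubeStructure W] (s : ℕ) (g : Z → W) : Prop where
  pos : 1 ≤ s
  glueing : HasGlueing Z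
  ergodic : IsErgodic W
  fibration : IsFibration g
  uniqueness : RelUniqueness g (s + 1)
  relErgodic : RelErgodic g s

section Transport

variable {Z : Type u} [CubeStructure Z] {s : ℕ} {x x' x'' y y' y'' z z' : Z}

theorem Transport.symm (h : Transport s x x' y y') : Transport s y y' x x' := by
  have hm : IsCubeMorphism fun (ω : DCube (s + 1)) i => if i = Fin.last s then !ω i else ω i := by
    intro i
    by_cases hi : i = Fin.last s
    · exact Or.inr (Or.inr ⟨i, fun x => by simp [hi]⟩)
    · exact Or.inr (Or.inl ⟨i, fun x => by simp [hi]⟩)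
  unfold Transport
  convert Cubes.comp hm h using 2 with ω
  have : (Fin.init fun i => if i = Fin.last s then !ω i else ω i) = Fin.init ω := by
    funext j
    simp [Fin.init, (Fin.castSucc_lt_last j).ne]
  simp only [pairConfig_cornerConfig, this]
  cases hω : ω (Fin.last s) <;> simp

theorem Transport.trans (hZ : HasGlueing Z) (h : Transport s x x' y y')
    (h' : Transport s y y' z z') : Transport s x x' z z' := by
  unfold Transport
  have hi : ∀ (ω : DCube (s + 1)) b, Fin.init (Function.update ω (Fin.last s) b) = Fin.init ω := by
    intro ω b
    funext j
    simp [Fin.init, (Fin.castSucc_lt_last j).ne]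
  convert hZ.glue (Fin.last s) h h' ?_ using 2 with ω
  · simp only [pairConfig_cornerConfig]
    by_cases hω : ω (Fin.last s) = true <;> simp [hω]
  · intro ω
    simp [pairConfig_cornerConfig, hi]

/-- The first cube takes the values `x'` and `y'` on the edge where the first `s` coordinates are
`1`; the second cube has just these values off that edge and can be glued in there. -/
theorem Transport.vcomp (hZ : HasGlueing Z) (h : Transport s x x' y y')
    (h' : Transport s x' x'' y' y'') : Transport s x x'' y y'' := by
  unfold Transport
  convert hZ.replace_upper_face (Finset.univ.erase (Fin.last s)) h h' ?_ using 2 with ω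
  · simp only [← init_eq_ones_iff, pairConfig_cornerConfig]
    split_ifs <;> rfl
  · intro ω hω
    rw [← init_eq_ones_iff] at hω
    simp only [pairConfig_cornerConfig, init_raise, raise_last, if_neg hω, if_true]

end Transport

/-- A configuration that does not depend on the `j`-th coordinate is a cube as soon as its face
`ω_j = 0` is. -/
theorem mem_cubes_of_update {X : Type u} [CubeStructure X] {n : ℕ} (j : Fin (n + 1))
    {e : DCube (n + 1) → X} (he : ∀ ω, e (Function.update ω j false) = e ω)
    (h : (fun η : DCube n => e (j.insertNth (α := fun _ => Bool) false η)) ∈ Cubes X n) :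
    e ∈ Cubes X (n + 1) := by
  convert Cubes.comp (isCubeMorphism_reindex j.succAbove) h using 2 with ω
  rw [← he ω]
  congr 1
  funext i
  refine Fin.succAboveCases j ?_ (fun m => ?_) i
  · simp
  · simp

namespace IsErgodicStep

variable {Z : Type u} {W : Type v} [TopologicalSpace Z] [TopologicalSpace W]
    [CubeStructure Z] [CubeStructure W] {s : ℕ} {g : Z → W} {x x' y y' : Z}

theorem mem_cubes_of_fiber (h : IsErgodicStep s g) {k : ℕ} (hk : k ≤ s) {c : DCube k → Z} {w : W}
    (hc : ∀ ω, g (c ω) = w) : c ∈ Cubes Z k := by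
  obtain _ | n := k
  · exact mem_cubes_zero _
  refine h.relErgodic (n + 1) (Nat.le_add_left _ _) hk c ?_
  rw [show g ∘ c = fun _ => w from funext hc]
  exact const_mem_cubes _ w

/-- Relative `1`-ergodicity over an ergodic base makes `Z` ergodic; here `1 ≤ s` is needed. -/
theorem pair_mem_cubes (h : IsErgodicStep s g) (x y : Z) {k : ℕ} (i : Fin k) :
    (fun ω : DCube k => if ω i = true then y else x) ∈ Cubes Z k := by
  have h1 : (fun ω : DCube 1 => if ω 0 = true then y else x) ∈ Cubes Z 1 := by
    refine h.relErgodic 1 le_rfl h.pos _ ?_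
    have : Cubes W 1 = univ := h.ergodic
    rw [this]
    trivial
  exact Cubes.comp (isCubeMorphism_reindex fun _ => i) h1

theorem transport_const (h : IsErgodicStep s g) (x y : Z) : Transport s x x y y := by
  unfold Transport
  convert h.pair_mem_cubes x y (Fin.last s) using 2 with ω
  simp [pairConfig_cornerConfig]

theorem transport_refl (h : IsErgodicStep s g) (hx : g x = g x') : Transport s x x' x x' := by
  unfold Transport
  convert Cubes.comp (isCubeMorphism_reindex Fin.castSucc)
    (h.mem_cubes_of_fiber le_rfl (c := cornerConfig s x x') (w := g x) fun ω => ?_) using 2 with ω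
  · rw [pairConfig_cornerConfig, ite_self, ite_self]
    rfl
  · unfold cornerConfig
    split_ifs
    exacts [hx.symm, rfl]

theorem existsUnique_transport (h : IsErgodicStep s g) (hx : g x = g x') (y : Z) :
    ∃! y', g y' = g y ∧ Transport s x x' y y' := by
  have hg : ∀ {y'}, g y' = g y → g ∘ pairConfig (cornerConfig s x x') (cornerConfig s y y') =
      fun ω => if ω (Fin.last s) = true then g y else g x := by
    intro y' hy'
    funext ω
    rw [Function.comp_apply, pairConfig_cornerConfig]
    split_ifs <;> simp [hx, hy']
  have hbase : (fun ω : DCube (s + 1) => if ω (Fin.last s) = true then g y else g x) ∈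
      Cubes W (s + 1) := by
    rw [← hg rfl]
    convert h.fibration.map_cubes _ _ (h.pair_mem_cubes x y (Fin.last s)) using 1
    rw [hg rfl]
    funext ω
    simp only [Function.comp_apply]
    split_ifs <;> rfl
  -- The second `y` only fills the top vertex, which the corner drops. The lower faces have
  -- dimension `s`, so relative ergodicity makes them cubes.
  obtain ⟨c, hc, h1, h2⟩ := h.fibration.lift (s + 1) _ hbase
    (fun ω => pairConfig (cornerConfig s x x') (cornerConfig s y y) ω.1)
    (fun i => h.relErgodic s h.pos le_rfl _ (by
      have hm : IsCubeMorphism fun ω : DCube s =>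
          (i.insertNth (α := fun _ => Bool) false ω : DCube (s + 1)) := by
        intro j
        refine Fin.succAboveCases i ?_ (fun m => ?_) j
        · exact Or.inl ⟨false, fun x => by simp⟩
        · exact Or.inr (Or.inl ⟨m, fun x => by simp⟩)
      rw [← hg rfl] at hbase
      exact Cubes.comp hm hbase))
    (fun ω => congrFun (hg rfl) ω.1)
  refine ⟨c (ones _), ⟨congrFun h2 (ones _), ?_⟩, ?_⟩
  · unfold Transport
    convert hc using 1
    funext ω
    by_cases hω : ω = ones (s + 1)
    · subst hω
      rw [pairConfig_cornerConfig_ones]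
    · rw [h1 ⟨ω, hω⟩]
      exact pairConfig_cornerConfig_congr _ _ _ _ _ hω
  · rintro y' ⟨hy', ht⟩
    have := congrFun (h.uniqueness _ ht c hc ((hg hy').trans h2.symm) fun ω hω => by
      rw [h1 ⟨ω, hω⟩]
      exact pairConfig_cornerConfig_congr _ _ _ _ _ hω) (ones (s + 1))
    rwa [pairConfig_cornerConfig_ones] at this

/-- In a fibre, rows and columns can be exchanged. -/
theorem transport_transpose (h : IsErgodicStep s g) (hx : g x' = g x) (hy : g y = g x)
    (ht : Transport s x x' y y') : Transport s x y x' y' := by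
  obtain ⟨r, rfl⟩ : ∃ r, s = r + 1 := ⟨s - 1, (Nat.sub_add_cancel h.pos).symm⟩
  -- The four points sit on the square in the coordinates `a` and `b` over the face `ω_S = 1`;
  -- exchanging rows and columns amounts to swapping `a` and `b`.
  let a : Fin (r + 2) := (Fin.last r).castSucc
  let b : Fin (r + 2) := Fin.last (r + 1)
  have hab : a ≠ b := (Fin.castSucc_lt_last _).ne
  let S : Finset (Fin (r + 2)) := (Finset.univ.erase a).erase b
  have haS : a ∉ S := by simp [S]
  have hbS : b ∉ S := by simp [S]
  have hinit : ∀ ω : DCube (r + 2), Fin.init ω = ones (r + 1) ↔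
      (∀ i ∈ S, ω i = true) ∧ ω a = true := by
    intro ω
    rw [init_eq_ones_iff]
    constructor
    · exact fun H => ⟨fun i hi => H i (by simpa [S, b] using Finset.ne_of_mem_erase hi),
        H a (by simpa using hab)⟩
    · rintro ⟨H1, H2⟩ i hi
      by_cases hia : i = a
      · rw [hia, H2]
      · exact H1 i (by simp at hi; simp [S, hia, b, hi])
  have hcub : ∀ {p q : Z}, g p = g x → g q = g x →
      (fun ω : DCube (r + 2) => if (∀ i ∈ S, ω i = true) ∧ ω b = true then q else p) ∈
        Cubes Z (r + 2) := by
    intro p q hp hq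
    refine mem_cubes_of_update a (fun ω => ?_) (h.mem_cubes_of_fiber le_rfl (w := g x) fun ω => ?_)
    · have h1 : ∀ i ∈ S, Function.update ω a false i = ω i := fun i hi =>
        Function.update_of_ne (fun h : i = a => haS (h ▸ hi)) _ _
      have h2 : Function.update ω a false b = ω b := Function.update_of_ne hab.symm _ _
      rw [h2]
      congr 2
      exact propext (forall₂_congr fun i hi => by rw [h1 i hi])
    · split_ifs <;> assumption
  have hraise : ∀ ω : DCube (r + 2), ∀ i ∈ S, raise S ω i = true := fun ω i hi => by
    simp [raise, hi]
  have hraise_b : ∀ ω : DCube (r + 2), raise S ω b = ω b := fun ω => by simp [raise, hbS]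
  -- This makes the configuration constantly `x` off the square, so that the swap affects only the
  -- square.
  have hQ := h.glueing.replace_upper_face S (hcub rfl hy) ht (by
    intro ω hω
    rw [pairConfig_cornerConfig, if_neg fun H => hω ((hinit ω).1 H).1, hraise_b]
    by_cases hb : ω b = true
    · rw [if_pos hb, if_pos ⟨hraise ω, hb⟩]
    · rw [if_neg hb, if_neg fun H => hb H.2])
  have hQ' := Cubes.comp (isCubeMorphism_reindex (Equiv.swap a b)) hQ
  have hS : ∀ ω : DCube (r + 2), (∀ i ∈ S, ω (Equiv.swap a b i) = true) ↔
      ∀ i ∈ S, ω i = true := fun ω => forall₂_congr fun i hi => by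
    rw [Equiv.swap_apply_of_ne_of_ne (fun h : i = a => haS (h ▸ hi))
      (fun h : i = b => hbS (h ▸ hi))]
  unfold Transport
  -- After the swap, the values `x` and `x'` of the row `b` are spread back over the vertices off
  -- the square.
  convert h.glueing.upper_face_of_eq S (hcub rfl hx) hQ' (by
    intro ω hω
    rw [if_neg fun H => hω H.1, if_neg fun H => hω ((hS ω).1 H), if_neg fun H => ?_]
    exact hω ((hS ω).1 H.1)) using 2 with ω
  simp only [hS, pairConfig_cornerConfig, hinit, hraise_b, Equiv.swap_apply_left]
  have hb' : (ω (Equiv.swap a b (Fin.last (r + 1)))) = ω a := by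
    rw [show Equiv.swap a b (Fin.last (r + 1)) = a from Equiv.swap_apply_right a b]
  by_cases hU : ∀ i ∈ S, ω i = true
  · simp only [hb']
    by_cases ha : ω a = true <;> by_cases hb : ω b = true <;>
      simp_all [b]
  · rw [if_neg fun H => hU H.1, if_neg hU]
    by_cases hb : ω b = true
    · rw [if_pos hb, if_pos ⟨hraise ω, hb⟩]
    · rw [if_neg hb, if_neg fun H => hb H.2]

end IsErgodicStep

/-! ## The structure group -/

namespace IsErgodicStep

variable {Z : Type u} {W : Type v} [TopologicalSpace Z] [TopologicalSpace W]
    [CubeStructure Z] [CubeStructure W] {s : ℕ} {g : Z → W} {z₀ : Z}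

/-- The fibre of `z₀`, which parametrizes the translations of `Z`. -/
abbrev Fiber (g : Z → W) (z₀ : Z) : Type u := {z : Z // g z = g z₀}

/-- The translation that moves `z₀` to `a`. -/
noncomputable def translate (h : IsErgodicStep s g) (a : Fiber g z₀) (y : Z) : Z :=
  (h.existsUnique_transport a.2.symm y).choose

variable (h : IsErgodicStep s g) (a b : Fiber g z₀)

theorem map_translate (y : Z) : g (h.translate a y) = g y :=
  (h.existsUnique_transport a.2.symm y).choose_spec.1.1

theorem transport_translate (y : Z) : Transport s z₀ a y (h.translate a y) :=
  (h.existsUnique_transport a.2.symm y).choose_spec.1.2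

variable {a b}

theorem eq_translate {y y' : Z} (hy : g y' = g y) (ht : Transport s z₀ a y y') :
    y' = h.translate a y :=
  (h.existsUnique_transport a.2.symm y).choose_spec.2 y' ⟨hy, ht⟩

theorem translate_eq_iff {y y' : Z} :
    h.translate a y = y' ↔ g y' = g y ∧ Transport s z₀ a y y' := by
  constructor
  · rintro rfl
    exact ⟨h.map_translate a y, h.transport_translate a y⟩
  · exact fun H => (h.eq_translate H.1 H.2).symm

variable (a) in
theorem transport_translate_translate (x y : Z) :
    Transport s x (h.translate a x) y (h.translate a y) :=
  (h.transport_translate a x).symm.trans h.glueing (h.transport_translate a y)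

variable (a) in
theorem translate_base : h.translate a z₀ = a :=
  (h.eq_translate a.2 (h.transport_refl a.2.symm)).symm

theorem translate_base_left (y : Z) : h.translate (⟨z₀, rfl⟩ : Fiber g z₀) y = y :=
  (h.eq_translate rfl (h.transport_const z₀ y)).symm

theorem eq_of_translate_eq {y : Z} (hy : h.translate a y = h.translate b y) : a = b := by
  have h1 := h.transport_translate a y
  rw [hy] at h1
  have h2 := h1.trans h.glueing (h.transport_translate b y).symm
  rw [Subtype.ext_iff, ← h.translate_base a]
  exact (h.eq_translate (b.2) h2).symm

-- Every transport class of pairs has a representative starting at `z₀`, so the fibre of `z₀` yields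
-- all translations.
variable (z₀) in
theorem exists_translate_eq {x x' y y' : Z} (hx : g x = g x') (hy : g y = g y')
    (ht : Transport s x x' y y') :
    ∃ a : Fiber g z₀, h.translate a x = x' ∧ h.translate a y = y' := by
  obtain ⟨a, ⟨ha, hta⟩, -⟩ := h.existsUnique_transport hx z₀
  exact ⟨⟨a, ha⟩, (h.eq_translate hx.symm hta.symm).symm,
    (h.eq_translate hy.symm (hta.symm.trans h.glueing ht)).symm⟩

variable (a b) in
theorem translate_translate (y : Z) :
    h.translate (⟨h.translate a b, (h.map_translate a b).trans b.2⟩ : Fiber g z₀) y =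
      h.translate a (h.translate b y) :=
  (h.eq_translate ((h.map_translate a _).trans (h.map_translate b y))
    ((h.transport_translate b y).vcomp h.glueing (h.transport_translate_translate a _ _))).symm

theorem exists_translate_eq_of_map_eq {x x' : Z} (hx : g x = g x') (z₀ : Z) :
    ∃ a : Fiber g z₀, h.translate a x = x' :=
  (h.exists_translate_eq z₀ hx hx (h.transport_refl hx)).imp fun _ => And.left

/-- Transposing the square `z₀, a; b, a + b` shows that `a + b` is also obtained by moving `a` along
`(z₀, b)`. -/
theorem translate_comm : h.translate a b = h.translate b a :=
  h.eq_translate ((h.map_translate a b).trans (b.2.trans a.2.symm))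
    (h.transport_transpose a.2 b.2 (h.transport_translate a b))

/-- The translations form an abelian group. -/
noncomputable abbrev addCommGroup (z₀ : Z) : AddCommGroup (Fiber g z₀) :=
  letI : Add (Fiber g z₀) := ⟨fun a b => ⟨h.translate a b, (h.map_translate a b).trans b.2⟩⟩
  letI : Zero (Fiber g z₀) := ⟨⟨z₀, rfl⟩⟩
  letI : Neg (Fiber g z₀) := ⟨fun a => (h.exists_translate_eq_of_map_eq a.2 z₀).choose⟩
  { AddGroup.ofLeftAxioms
      (fun a b c : Fiber g z₀ => Subtype.ext (h.translate_translate a b c))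
      (fun a => Subtype.ext (h.translate_base_left a))
      (fun a => Subtype.ext (h.exists_translate_eq_of_map_eq a.2 z₀).choose_spec) with
    add_comm := fun _ _ => Subtype.ext h.translate_comm }

/-- The action of the group of translations. -/
noncomputable abbrev addAction (z₀ : Z) :
    letI := h.addCommGroup z₀
    AddAction (Fiber g z₀) Z :=
  letI := h.addCommGroup z₀
  { vadd := h.translate
    zero_vadd := h.translate_base_left
    add_vadd := fun a b y => h.translate_translate a b y }

/-! ### Topology of the translation group. -/

theorem isClosed_graph_translate (hZ : IsCompactCubespace Z) [T2Space W] :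
    IsClosed {p : (Fiber g z₀ × Z) × Z | h.translate p.1.1 p.1.2 = p.2} := by
  have := h.fibration.continuous
  simp only [translate_eq_iff]
  refine (isClosed_eq (by fun_prop) (by fun_prop)).inter ?_
  have hc : Continuous fun p : (Fiber g z₀ × Z) × Z => ((z₀, (p.1.1 : Z)), p.1.2, p.2) := by
    fun_prop
  exact (hZ.closed (s + 1)).preimage ((continuous_pairConfig_cornerConfig Z s).comp hc)

theorem continuous_translate (hZ : IsCompactCubespace Z) [T2Space W] :
    Continuous fun p : Fiber g z₀ × Z => h.translate p.1 p.2 := by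
  have := hZ.compact
  exact continuous_of_isClosed_graph_of_compact _ (h.isClosed_graph_translate hZ)

theorem compactSpace_fiber (h : IsErgodicStep s g) (hZ : IsCompactCubespace Z) [T2Space W] (z₀ : Z) :
    CompactSpace (Fiber g z₀) := by
  have := hZ.compact
  exact isCompact_iff_compactSpace.1
    (isClosed_eq h.fibration.continuous continuous_const).isCompact

theorem isTopologicalAddGroup (hZ : IsCompactCubespace Z) [T2Space W] (z₀ : Z) :
    letI := h.addCommGroup z₀
    IsTopologicalAddGroup (Fiber g z₀) := by
  let _ := h.addCommGroup z₀
  have := h.compactSpace_fiber hZ z₀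
  have := hZ.metrizable
  have hadd : Continuous fun p : Fiber g z₀ × Fiber g z₀ => p.1 + p.2 := by
    refine Continuous.subtype_mk ?_ _
    exact (h.continuous_translate hZ).comp
      (continuous_fst.prodMk (continuous_subtype_val.comp continuous_snd))
  refine { continuous_add := hadd, continuous_neg := ?_ }
  refine continuous_of_isClosed_graph_of_compact _ ?_
  simp only [neg_eq_iff_add_eq_zero]
  exact isClosed_eq hadd continuous_const

end IsErgodicStep

/-! ## The action of the Host–Kra cubes -/

namespace IsErgodicStep

variable {Z : Type u} {W : Type v} [TopologicalSpace Z] [TopologicalSpace W]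
    [CubeStructure Z] [CubeStructure W] {s : ℕ} {g : Z → W} {z₀ : Z} {k : ℕ}

/-- Induction over the vertices `ω`, treating the face below `ω`. If `ω` is off the face `ω_S = 1`,
nothing has been moved. If `ω` is the indicator of `S`, the configuration is an `s`-dimensional one
in a single fibre, hence a cube. Otherwise some further coordinate `j` equals `1`, and the corner
completion at `ω` must be the translate by uniqueness of transport. -/
theorem translate_face_mem_of_raise (h : IsErgodicStep s g) (a : Fiber g z₀)
    {S : Finset (Fin k)} (hS : S.card = s) {c : DCube k → Z} (hc : c ∈ Cubes Z k)
    (hcS : ∀ ω, c (raise S ω) = c ω) :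
    (fun ω => if ∀ i ∈ S, ω i = true then h.translate a (c ω) else c ω) ∈ Cubes Z k := by
  classical
  set d : DCube k → Z := fun ω => if ∀ i ∈ S, ω i = true then h.translate a (c ω) else c ω
    with hd
  have hgd : ∀ ω, g (d ω) = g (c ω) := fun ω => by
    simp only [hd]
    split_ifs
    exacts [h.map_translate a _, rfl]
  let σ : S ≃ Fin s := S.equivFinOfCardEq hS
  suffices H : ∀ ω, (fun η => d (η ⊓ ω)) ∈ Cubes Z k from mem_cubes_of_le_ones (H (ones k))
  intro ω
  induction ω using WellFoundedLT.induction with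
  | _ ω ih =>
  by_cases hω : ∀ i ∈ S, ω i = true
  swap
  · convert Cubes.comp (isCubeMorphism_inf ω) hc using 2 with η
    refine if_neg fun H => hω fun i hi => ?_
    have := H i hi
    simp only [Pi.inf_apply] at this
    revert this
    cases ω i <;> simp
  by_cases hj : ∃ j ∉ S, ω j = true
  · obtain ⟨j, hjS, hj⟩ := hj
    obtain ⟨d', hd', h1, h2, h3⟩ := h.fibration.exists_extension_at (c := g ∘ c) (l := d) ω
      (Cubes.comp (isCubeMorphism_inf ω) (h.fibration.map_cubes k c hc)) ih fun η _ => hgd η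
    -- The `(s+1)`-face with top `ω` in the directions `S` and `j`. As `c` is constant in the
    -- directions of `S`, it takes only two values there, and the completion `d'` becomes a
    -- transport configuration.
    let e : DCube (s + 1) → DCube k := fun ξ i =>
      if hi : i ∈ S then ξ (σ ⟨i, hi⟩).castSucc else if i = j then ξ (Fin.last s) else ω i
    have he : IsCubeMorphism e := by
      intro i
      by_cases hi : i ∈ S
      · exact Or.inr (Or.inl ⟨(σ ⟨i, hi⟩).castSucc, fun x => by simp [e, hi]⟩)
      by_cases hij : i = j
      · exact Or.inr (Or.inl ⟨Fin.last s, fun x => by simp [e, hij, hjS]⟩)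
      · exact Or.inl ⟨ω i, fun x => by simp [e, hi, hij]⟩
    have heS : ∀ ξ, (∀ i ∈ S, e ξ i = true) ↔ Fin.init ξ = ones s := by
      intro ξ
      constructor
      · intro H
        funext m
        have := H _ (σ.symm m).2
        simpa [e, Fin.init, ones] using this
      · intro H i hi
        have := congrFun H (σ ⟨i, hi⟩)
        simpa [e, hi, Fin.init, ones] using this
    have hele : ∀ ξ, e ξ ≤ ω := by
      intro ξ i
      by_cases hi : i ∈ S
      · rw [hω i hi]
        exact le_top
      by_cases hij : i = j
      · rw [hij, hj]
        exact le_top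
      · simp [e, hi, hij]
    have hej : ∀ ξ, e ξ j = ξ (Fin.last s) := fun ξ => by simp [e, hjS]
    have helt : ∀ ξ, ξ ≠ ones (s + 1) → e ξ < ω := by
      refine fun ξ hξ => lt_of_le_of_ne (hele ξ) fun H => hξ ?_
      rw [← init_eq_ones_and_last_iff]
      refine ⟨(heS ξ).1 (by rwa [H]), ?_⟩
      rw [← hej ξ, H, hj]
    have heω : e (ones (s + 1)) = ω := by
      funext i
      by_cases hi : i ∈ S
      · simp [e, hi, hω, ones]
      by_cases hij : i = j
      · simp [e, hij, hj, hjS, ones]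
      · simp [e, hi, hij]
    have hce : ∀ ξ, c (e ξ) = if ξ (Fin.last s) = true then c ω
        else c (Function.update ω j false) := by
      intro ξ
      have : raise S (e ξ) = Function.update ω j (ξ (Fin.last s)) := by
        funext i
        by_cases hi : i ∈ S
        · have hij : i ≠ j := fun h => hjS (h ▸ hi)
          simp [raise, hi, hij, hω]
        by_cases hij : i = j
        · subst hij
          simp [raise, hi, hej]
        · simp [raise, hi, hij, e]
      rw [← hcS, this]
      cases hξ : ξ (Fin.last s)
      · simp
      · rw [if_pos rfl, ← hj, Function.update_eq_self]
    have ht : Transport s (c (Function.update ω j false))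
        (h.translate a (c (Function.update ω j false))) (c ω) (d' ω) := by
      unfold Transport
      convert Cubes.comp he hd' using 2 with ξ
      by_cases hξ : ξ = ones (s + 1)
      · rw [hξ, pairConfig_cornerConfig_ones, heω]
      · rw [h1 _ (helt ξ hξ), pairConfig_cornerConfig_congr _ _ _ _ (h.translate a (c ω)) hξ,
          pairConfig_cornerConfig]
        simp only [hd, heS, hce]
        split_ifs <;> rfl
    have hdω : d' ω = d ω := by
      have hdω : d ω = h.translate a (c ω) := if_pos hω
      rw [hdω]
      refine (h.existsUnique_transport (h.map_translate a _).symm (c ω)).unique ⟨?_, ht⟩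
        ⟨h.map_translate a _, h.transport_translate_translate a _ _⟩
      rw [h3, inf_idem, Function.comp_apply]
    convert hd' using 2 with η
    rw [h2]
    rcases (inf_le_right : η ⊓ ω ≤ ω).eq_or_lt with H | H
    · rw [H, hdω]
    · rw [h1 _ H]
  · have hj' : ∀ j ∉ S, ω j = false := fun j hjS => by
      by_contra H
      exact hj ⟨j, hjS, by simpa using H⟩
    have hcorner : cornerConfig s (c ω) (h.translate a (c ω)) ∈ Cubes Z s :=
      h.mem_cubes_of_fiber le_rfl (w := g (c ω)) fun ξ => by
        unfold cornerConfig
        split_ifs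
        exacts [h.map_translate a _, rfl]
    convert Cubes.comp (isCubeMorphism_reindex fun m => (σ.symm m).1) hcorner using 2 with η
    have h1 : c (η ⊓ ω) = c ω := by
      rw [← hcS (η ⊓ ω)]
      congr 1
      funext i
      by_cases hi : i ∈ S
      · simp [raise, hi, hω]
      · simp [raise, hi, hj']
    have h2 : (∀ i ∈ S, (η ⊓ ω) i = true) ↔ (fun m => η (σ.symm m).1) = ones s := by
      constructor
      · intro H
        funext m
        have := H _ (σ.symm m).2
        rw [Pi.inf_apply, hω _ (σ.symm m).2] at this
        simpa [ones] using this
      · intro H i hi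
        rw [Pi.inf_apply, hω i hi]
        simpa [ones] using congrFun H (σ ⟨i, hi⟩)
    simp only [hd, h1, h2, cornerConfig]

/-- Translating an upper face of codimension at most `s` of a cube gives a cube. -/
theorem translate_face_mem (h : IsErgodicStep s g) (a : Fiber g z₀)
    (S : Finset (Fin k)) (hS : S.card ≤ s) {c : DCube k → Z} (hc : c ∈ Cubes Z k) :
    (fun ω => if ∀ i ∈ S, ω i = true then h.translate a (c ω) else c ω) ∈ Cubes Z k := by
  induction hn : s - S.card generalizing k with
  | zero =>
    have hraise : ∀ ω : DCube k, raise S (raise S ω) = raise S ω := fun ω => by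
      funext i
      by_cases hi : i ∈ S <;> simp [raise, hi]
    -- In codimension exactly `s`, the translate of the retraction of `c` to the face is a cube, and
    -- it is glued onto `c` along that face.
    convert h.glueing.replace_upper_face S hc (h.translate_face_mem_of_raise a (S := S) (by omega)
      (Cubes.comp (isCubeMorphism_raise S) hc) fun ω => by rw [hraise]) ?_ using 2 with ω
    · by_cases hω : ∀ i ∈ S, ω i = true
      · have : raise S ω = ω := by
          funext i
          by_cases hi : i ∈ S <;> simp [raise, hi, hω]
        simp only [if_pos hω, this]
      · simp only [if_neg hω]
    · intro ω hω
      exact if_neg hω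
  | succ n ih =>
    have hlast : Fin.last k ∉ S.map Fin.castSuccEmb := by
      simp [(Fin.castSucc_lt_last _).ne]
    have hm : IsCubeMorphism fun ω : DCube k =>
        (Fin.snoc (α := fun _ => Bool) ω true : DCube (k + 1)) := by
      intro i
      refine Fin.lastCases ?_ (fun j => ?_) i
      · exact Or.inl ⟨true, fun x => by simp⟩
      · exact Or.inr (Or.inl ⟨j, fun x => by simp⟩)
    have hcard : (insert (Fin.last k) (S.map Fin.castSuccEmb)).card = S.card + 1 := by
      rw [Finset.card_insert_of_notMem hlast, Finset.card_map]
    -- A dummy coordinate raises the codimension by one; restricting to its value `1` recovers the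
    -- original face.
    have := Cubes.comp hm (ih (insert (Fin.last k) (S.map Fin.castSuccEmb)) (by omega)
      (Cubes.comp (isCubeMorphism_reindex Fin.castSucc) hc) (by omega))
    simpa using this

end IsErgodicStep

section HostKra

variable {Z : Type u} {W : Type v} [CubeStructure Z] {A : Type u} [AddCommGroup A]
  [AddAction A Z] {s k : ℕ} {g : Z → W}

theorem vadd_mem_cubes (H : ∀ (k : ℕ) (a : A) (S : Finset (Fin k)), S.card ≤ s →
      ∀ c ∈ Cubes Z k, (fun ω => if ∀ i ∈ S, ω i = true then a +ᵥ c ω else c ω) ∈ Cubes Z k)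
    {a : DCube k → A} (ha : a ∈ dCubes A s k) {c : DCube k → Z} (hc : c ∈ Cubes Z k) :
    (fun ω => a ω +ᵥ c ω) ∈ Cubes Z k := by
  -- The inverse is carried along for the negation case of the closure induction. Generators with
  -- `|S| > s` have coefficient `0`.
  suffices h : ∀ c ∈ Cubes Z k, (fun ω => a ω +ᵥ c ω) ∈ Cubes Z k ∧
      (fun ω => -a ω +ᵥ c ω) ∈ Cubes Z k from (h c hc).1
  clear hc c
  refine AddSubgroup.closure_induction (p := fun (a : DCube k → A) _ => ∀ c ∈ Cubes Z k,
      (fun ω => a ω +ᵥ c ω) ∈ Cubes Z k ∧ (fun ω => -a ω +ᵥ c ω) ∈ Cubes Z k)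
    ?_ ?_ ?_ ?_ ha
  · rintro _ ⟨S, b, hb, rfl⟩ c hc
    by_cases hS : S.card ≤ s
    · refine ⟨?_, ?_⟩
      · convert H k b S hS c hc using 2 with ω
        by_cases hω : ∀ i ∈ S, ω i = true
        · simp only [if_pos hω]
        · simp only [if_neg hω, zero_vadd]
      · convert H k (-b) S hS c hc using 2 with ω
        by_cases hω : ∀ i ∈ S, ω i = true
        · simp only [if_pos hω]
        · simp only [if_neg hω, neg_zero, zero_vadd]
    · have : b = 0 := by simpa [degreeFiltration, hS] using hb
      simpa [this] using hc
  · intro c hc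
    simpa using hc
  · intro a b _ _ ha hb c hc
    refine ⟨?_, ?_⟩
    · simpa [add_vadd] using (ha _ (hb c hc).1).1
    · simpa [add_vadd, add_comm] using (ha _ (hb c hc).2).2
  · intro a _ ha c hc
    simpa using (ha c hc).symm

/-- Every configuration agrees with a Host–Kra cube at the vertices of weight at most `s`. -/
theorem exists_mem_dCubes_eq (A : Type u) [AddCommGroup A] (s : ℕ) (b : DCube k → A) :
    ∃ a ∈ dCubes A s k, ∀ ω : DCube k, (Finset.univ.filter fun i => ω i = true).card ≤ s →
      a ω = b ω := by
  suffices H : ∀ n ≤ s + 1, ∃ a ∈ dCubes A s k, ∀ ω : DCube k,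
      (Finset.univ.filter fun i => ω i = true).card < n → a ω = b ω by
    obtain ⟨a, ha, h⟩ := H (s + 1) le_rfl
    exact ⟨a, ha, fun ω hω => h ω (Nat.lt_succ_of_le hω)⟩
  intro n
  induction n with
  | zero => exact fun _ => ⟨0, zero_mem _, fun ω hω => absurd hω (Nat.not_lt_zero _)⟩
  | succ n ih =>
    intro hn
    obtain ⟨a, ha, h⟩ := ih (by omega)
    -- The error at the indicator of `S`. Corrections on the faces with `|S| = n` vanish at weight
    -- below `n`, and at weight `n` only the face of the vertex itself contributes.
    let v : Finset (Fin k) → A := fun S => (b - a) fun i => decide (i ∈ S)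
    refine ⟨a + ∑ S ∈ Finset.powersetCard n Finset.univ,
        fun ω => if ∀ i ∈ S, ω i = true then v S else 0, add_mem ha (sum_mem fun S hS => ?_), ?_⟩
    · refine AddSubgroup.subset_closure ⟨S, v S, ?_, rfl⟩
      rw [(Finset.mem_powersetCard.1 hS).2, degreeFiltration, if_pos (by omega)]
      trivial
    · intro ω hω
      set T := Finset.univ.filter fun i => ω i = true with hT
      have hsub : ∀ S : Finset (Fin k), (∀ i ∈ S, ω i = true) ↔ S ⊆ T := fun S => by
        simp [hT, Finset.subset_iff]
      simp only [Pi.add_apply, Finset.sum_apply, hsub]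
      rcases (Nat.lt_succ_iff.1 hω).lt_or_eq with hlt | heq
      · rw [h ω hlt, Finset.sum_eq_zero, add_zero]
        intro S hS
        refine if_neg fun hST => ?_
        have := Finset.card_le_card hST
        have := (Finset.mem_powersetCard.1 hS).2
        omega
      · rw [Finset.sum_eq_single T]
        · have : (fun i => decide (i ∈ T)) = ω := by
            funext i
            simp [hT]
          simp [v, this]
        · intro S hS hne
          refine if_neg fun hST => hne (Finset.eq_of_subset_of_card_le hST ?_)
          rw [(Finset.mem_powersetCard.1 hS).2, heq]
        · intro hT'
          exact absurd (Finset.mem_powersetCard.2 ⟨Finset.subset_univ T, heq⟩) hT'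

/-- Cubes with the same image that agree at the vertices of weight at most `s` are equal. -/
theorem RelUniqueness.eq_of_eq_on_skeleton (hg : RelUniqueness g (s + 1)) {c c' : DCube k → Z}
    (hc : c ∈ Cubes Z k) (hc' : c' ∈ Cubes Z k) (hgc : g ∘ c = g ∘ c')
    (h : ∀ ω : DCube k, (Finset.univ.filter fun i => ω i = true).card ≤ s → c ω = c' ω) :
    c = c' := by
  funext ω
  induction ω using WellFoundedLT.induction with
  | _ ω ih =>
  by_cases hω : (Finset.univ.filter fun i => ω i = true).card ≤ s
  · exact h ω hω
  obtain ⟨e, r, he, -, her, hre, -, hrω⟩ := exists_lower_face ω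
  have heω : e (ones _) = ω := by rw [← hrω, her, inf_idem]
  -- The face below `ω` has dimension above `s`, so uniqueness determines its top vertex from the
  -- vertices handled by induction.
  have hcard : s + 1 ≤ Fintype.card {i // ω i = true} := by
    rw [Fintype.card_subtype]
    omega
  have := congrFun (relUniqueness_mono hcard hg _ (Cubes.comp he hc) _ (Cubes.comp he hc')
    (funext fun ξ => congrFun hgc (e ξ)) fun ξ hξ => ih _ (lt_of_le_of_ne ?_ fun H => hξ ?_))
    (ones _)
  · rwa [heω] at this
  · rw [← inf_eq_left, ← her, hre]
  · rw [← hre ξ, H, hrω]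

/-- The vertexwise differences need not form a Host–Kra cube a priori. One that agrees with them on
the skeleton of weight at most `s` moves `c` to a cube agreeing with `c'` there, hence to `c'`. -/
theorem exists_mem_dCubes_vadd_eq (hg : RelUniqueness g (s + 1))
    (hgA : ∀ (a : A) (z : Z), g (a +ᵥ z) = g z)  (orbits : ∀ z z' : Z, g z = g z' → ∃ a : A, a +ᵥ z = z')
    (hA : ∀ a ∈ dCubes A s k, ∀ c ∈ Cubes Z k, (fun ω => a ω +ᵥ c ω) ∈ Cubes Z k)
    {c c' : DCube k → Z} (hc : c ∈ Cubes Z k) (hc' : c' ∈ Cubes Z k) (hgc : g ∘ c = g ∘ c') :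
    ∃ a ∈ dCubes A s k, (fun ω => a ω +ᵥ c ω) = c' := by
  choose b hb using fun ω => orbits (c ω) (c' ω) (congrFun hgc ω)
  obtain ⟨a, ha, hab⟩ := exists_mem_dCubes_eq A s b
  refine ⟨a, ha, hg.eq_of_eq_on_skeleton (hA a ha c hc) hc' ?_ fun ω hω => ?_⟩
  · rw [← hgc]
    exact funext fun ω => hgA _ _
  · rw [hab ω hω, hb]

end HostKra

theorem IsErgodicStep.exists_structureGroup {Z : Type u} {W : Type v} [TopologicalSpace Z]
    [TopologicalSpace W] [CubeStructure Z] [CubeStructure W] {s : ℕ} {g : Z → W}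
    (h : IsErgodicStep s g) (hZ : IsCompactCubespace Z) [T2Space W] :
    ∃ (A : Type u) (_ : AddCommGroup A) (_ : TopologicalSpace A) (_ : AddAction A Z),
      IsStructureGroup s g A := by
  -- An empty `Z` offers no base point; the trivial group serves in that case.
  rcases isEmpty_or_nonempty Z with hZe | ⟨⟨z₀⟩⟩
  · let _ : AddAction PUnit.{u + 1} Z :=
      { vadd := fun _ z => z, zero_vadd := fun _ => rfl, add_vadd := fun _ _ _ => rfl }
    refine ⟨PUnit, inferInstance, inferInstance, inferInstance, ?_⟩
    exact
      { topGroup := inferInstance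
        compact := inferInstance
        metrizable := inferInstance
        continuous := ⟨continuous_snd⟩
        free := fun _ x => isEmptyElim x
        orbits := fun x => isEmptyElim x
        cubes_action := fun k _ _ c => isEmptyElim (c (ones k))
        cubes_free := fun k _ _ c => isEmptyElim (c (ones k))
        cubes_orbits := fun k c => isEmptyElim (c (ones k))
        classes := fun x => isEmptyElim x }
  let _ := h.addCommGroup z₀
  let _ := h.addAction z₀
  have := hZ.metrizable
  have free : ∀ (a : IsErgodicStep.Fiber g z₀) (x : Z), a +ᵥ x = x → a = 0 := fun a x hx =>
    h.eq_of_translate_eq (hx.trans (zero_vadd (IsErgodicStep.Fiber g z₀) x).symm)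
  have orbits : ∀ x x' : Z, g x = g x' → ∃ a : IsErgodicStep.Fiber g z₀, a +ᵥ x = x' :=
    fun x x' hx => h.exists_translate_eq_of_map_eq hx z₀
  have map_vadd : ∀ (a : IsErgodicStep.Fiber g z₀) (x : Z), g (a +ᵥ x) = g x := h.map_translate
  have action : ∀ k : ℕ, ∀ a ∈ dCubes (IsErgodicStep.Fiber g z₀) s k, ∀ c ∈ Cubes Z k,
      (fun ω => a ω +ᵥ c ω) ∈ Cubes Z k := fun k a ha c hc =>
    vadd_mem_cubes (fun k a S hS c hc => h.translate_face_mem a S hS hc) ha hc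
  refine ⟨IsErgodicStep.Fiber g z₀, inferInstance, inferInstance, inferInstance, ?_⟩
  exact
    { topGroup := h.isTopologicalAddGroup hZ z₀
      compact := h.compactSpace_fiber hZ z₀
      metrizable := IsEmbedding.subtypeVal.metrizableSpace
      continuous := ⟨h.continuous_translate hZ⟩
      free := free
      orbits := fun x x' => ⟨orbits x x', by
        rintro ⟨a, rfl⟩
        exact (map_vadd a x).symm⟩
      cubes_action := action
      cubes_free := fun k a _ c _ hac => funext fun ω => free _ _ (congrFun hac ω)
      cubes_orbits := fun k c hc c' hc' =>
        ⟨exists_mem_dCubes_vadd_eq h.uniqueness map_vadd orbits (action k) hc hc', by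
          rintro ⟨a, -, rfl⟩
          exact funext fun ω => (map_vadd _ _).symm⟩
      classes := fun x x' y y' hx hy => ⟨h.exists_translate_eq z₀ hx hy, by
        rintro ⟨a, rfl, rfl⟩
        exact h.transport_translate_translate a x y⟩ }

/-! ## The structure theorem -/

theorem mainTheorem3 {X : Type u} {Y : Type v} [TopologicalSpace X] [TopologicalSpace Y]
    [CubeStructure X] [CubeStructure Y]
    (hX : IsCompactCubespace X) (hXe : IsErgodic X) (hXg : HasGlueing X)
    (hY : IsCompactCubespace Y) (hYe : IsErgodic Y) (hYg : HasGlueing Y)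
    (s : ℕ) (f : X → Y) (hf : IsFibration f) (hs : DegreeAtMost f s) :
    -- the canonical relations are closed equivalence relations, and the canonical factors are
    -- compact ergodic cubespaces with the glueing property through which `f` factors
    (∀ i ≤ s,
      Equivalence (CanonRel f i) ∧ IsClosed {p : X × X | CanonRel f i p.1 p.2} ∧
      IsCompactCubespace (Factor f i) ∧ IsErgodic (Factor f i) ∧ HasGlueing (Factor f i) ∧
      IsFibration (proj f i) ∧ IsFibration (toBase f i) ∧ DegreeAtMost (toBase f i) i ∧
      toBase f i ∘ proj f i = f) ∧
    -- the two ends of the tower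
    IsCubespaceIso (proj f s) ∧ IsCubespaceIso (toBase f 0) ∧
    -- the steps of the tower and their structure groups
    (∀ i < s,
      step f i ∘ proj f (i + 1) = proj f i ∧ toBase f i ∘ step f i = toBase f (i + 1) ∧
      IsFibration (step f i) ∧ DegreeAtMost (step f i) (i + 1) ∧ RelErgodic (step f i) (i + 1) ∧
      ∃ (A : Type u) (_ : AddCommGroup A) (_ : TopologicalSpace A)
        (_ : AddAction A (Factor f (i + 1))), IsStructureGroup (i + 1) (step f i) A) := by
  have := hX.compact
  have := hY.metrizable
  have key : ∀ i, Equivalence (CanonRel f i) ∧ IsClosed {p : X × X | CanonRel f i p.1 p.2} ∧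
      IsCompactCubespace (Factor f i) ∧ IsErgodic (Factor f i) ∧ HasGlueing (Factor f i) := fun i =>
    have hcl := isClosed_canonRel hX hXg hf.continuous i
    ⟨canonRel_equivalence hXg f i, hcl,
      isCompactCubespace_quot hX (canonRel_equivalence hXg f i) hcl, isErgodic_quot hXe _,
      (isFibration_proj hXg hf i).hasGlueing hXg⟩
  refine ⟨fun i _ => ?_, ?_, ?_, fun i _ => ?_⟩
  · obtain ⟨h1, h2, h3, h4, h5⟩ := key i
    exact ⟨h1, h2, h3, h4, h5, isFibration_proj hXg hf i, isFibration_toBase hXg hf i,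
      ⟨i + 1, le_rfl, relUniqueness_toBase hXg f i⟩, rfl⟩
  · have := (key s).2.2.1.metrizable
    exact isCubespaceIso_of_injective (isFibration_proj hXg hf s) (injective_proj hXg hs)
  · have := (key 0).2.2.1.compact
    exact isCubespaceIso_of_injective (isFibration_toBase hXg hf 0) (injective_toBase_zero hXe f)
  · obtain ⟨-, -, h3, h4, h5⟩ := key (i + 1)
    have := (key i).2.2.1.metrizable
    refine ⟨rfl, toBase_comp_step f i, isFibration_step hXg hf i, degreeAtMost_step hXg f i,
      relErgodic_step hXg f i, IsErgodicStep.exists_structureGroup (s := i + 1) ?_ h3⟩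
    -- The step from `i + 1` to `i` has parameter `i + 1`, so the parameter is always at least `1`.
    exact
      { pos := Nat.le_add_left 1 i
        glueing := h5
        ergodic := (key i).2.2.2.1
        fibration := isFibration_step hXg hf i
        uniqueness := (degreeAtMost_step hXg f i).relUniqueness
        relErgodic := relErgodic_step hXg f i }
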